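/- All Lie algebras are real and finite-dimensional. For a Lie algebra $\mathfrak{g}$ with basis $X_1,\dots,X_n$, structure constants $[X_i,X_j]=\sum_k C_{ij}^kX_k$ and linear coordinates $x_1,\dots,x_n$ on $\mathfrak{g}^*$, put $\mathcal{N}(\mathfrak{g})=\dim\mathfrak{g}-\operatorname{rank}\left(\sum_k C_{ij}^kx_k\right)$, where the rank is the generic, i.e. maximal, rank over all points $x\in\mathfrak{g}^*$. An invariant of $\mathfrak{g}$ is a function $F\in C^\infty(\mathfrak{g}^*)$ with $\sum_{j,k}C_{ij}^kx_k\,\partial F/\partial x_j=0$ for $1\le i\le n$. Functions are functionally independent if their differentials are linearly independent at all points of a dense set. For a subalgebra $\mathfrak{h}\subset\mathfrak{g}$, the number of available (missing) labelling operators of the chain $\mathfrak{g}\supset\mathfrak{h}$ is $$\dim\mathfrak{g}-\mathcal{N}(\mathfrak{g})-\dim\mathfrak{h}-\mathcal{N}(\mathfrak{h})+2l',$$ where $l'$ is the maximal number of functionally independent invariants of $\mathfrak{g}$ that depend only on the variables of $\mathfrak{h}$, i.e. whose value at $x\in\mathfrak{g}^*$ depends only on $x|_{\mathfrak{h}}$.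 A (generalized Inönü–Wigner) contraction $\mathfrak{s}\rightsquigarrow\mathfrak{g}$ is given by a basis $X_1,\dots,X_n$ of $\mathfrak{s}$ and integers $n_1,\dots,n_n$ such that, for the maps $\Phi_t(X_j)=t^{n_j}X_j$ ($t\geq 1$), the limit $[Y,Z]_\infty=\lim_{t\to\infty}\Phi_t^{-1}[\Phi_t(Y),\Phi_t(Z)]$ exists for all $Y,Z\in\mathfrak{s}$, and $\mathfrak{g}$ is the vector space $\mathfrak{s}$ with the bracket $[\cdot,\cdot]_\infty$. Let $\mathfrak{s}\rightsquigarrow\mathfrak{g}$ be such a contraction and let $\mathfrak{s}'\subset\mathfrak{s}$ be a subalgebra that it leaves invariant, i.e. $\Phi_t(Y)=Y$ for all $Y\in\mathfrak{s}'$ and $t\ge1$; then $\mathfrak{s}'$ is also a subalgebra of $\mathfrak{g}$. Let $m$ and $\widetilde m$ be the numbers of available labelling operators of the chains $\mathfrak{s}\supset\mathfrak{s}'$ and $\mathfrak{g}\supset\mathfrak{s}'$. (a) Suppose that all $\Phi_t$ commute with $\operatorname{ad}Y$ for every $Y\in\mathfrak{s}'$ (as for the contraction $\Phi_t=\mathrm{id}$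 on $\mathfrak{s}'$, $\Phi_t=t^{-1}\mathrm{id}$ on $R$, associated to a decomposition $\mathfrak{s}=\mathfrak{s}'\oplus R$ with $[\mathfrak{s}',R]\subset R$), or that $\mathfrak{s}$ is a completely reducible representation of $\mathfrak{s}'$ under $\operatorname{ad}$. Then $$\mathcal{N}(\mathfrak{g})=\mathcal{N}(\mathfrak{s})+m-\widetilde m.$$ (b) If $\mathfrak{s}$ is a completely reducible representation of $\mathfrak{s}'$, then moreover $\mathcal{N}(\mathfrak{g})\le\mathcal{N}(\mathfrak{s})+m$. -/

import Mathlib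

open scoped ContDiff

namespace LieLabelling

noncomputable section

section Invariants

variable (L : Type*) [LieRing L] [LieAlgebra ℝ L]

/-- For `x` in the dual of `L`, the bilinear form `(X, Y) ↦ x ⁅X, Y⁆`. In a basis `X₁, …, Xₙ` with
structure constants `C i j k` its matrix is the commutator matrix `(∑ k, C i j k * x k)`,
evaluated at the point `x`. -/
def commutatorForm (x : Module.Dual ℝ L) : L →ₗ[ℝ] Module.Dual ℝ L :=
  (LieModule.toEnd ℝ L L : L →ₗ[ℝ] Module.End ℝ L).compr₂ x

/-- The (generic) rank of the commutator matrix `(∑ k, C i j k * x k)`: the largest rank that it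
attains at a point `x` of the dual. -/
def commutatorRank : ℕ :=
  ⨆ x : Module.Dual ℝ L, Module.finrank ℝ (LinearMap.range (commutatorForm L x))

/-- The number of invariants, `𝒩(L) = dim L - rank (∑ k, C i j k * x k)`. The rank never exceeds
the dimension, so that the subtraction does not truncate. -/
def numInvariants : ℕ :=
  Module.finrank ℝ L - commutatorRank L

variable [FiniteDimensional ℝ L]

/-- Linear coordinates `(x₁, …, xₙ)` on the dual of `L`, with respect to the dual of a basis. -/
def dualCoord : (Fin (Module.finrank ℝ L) → ℝ) ≃ₗ[ℝ] Module.Dual ℝ L :=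
  (Module.finBasis ℝ L).dualBasis.equivFun.symm

variable {L}

/-- `F ∈ C^∞(L*)`: `F` is a smooth function of the linear coordinates of `L*`. -/
def IsSmooth (F : Module.Dual ℝ L → ℝ) : Prop :=
  ContDiff ℝ ∞ fun y => F (dualCoord L y)

/-- `F` is annihilated by all the operators `X̂ᵢ = ∑ j k, C i j k * x k * ∂/∂x j`: at the point `x`
the operator of `X ∈ L` is the derivative in the direction `Y ↦ x ⁅X, Y⁆`. -/
def IsInvariant (F : Module.Dual ℝ L → ℝ) : Prop :=
  ∀ (X : L) (x : Module.Dual ℝ L), lineDeriv ℝ F x (commutatorForm L x X) = 0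

/-- `F` depends only on the variables of the subalgebra `H`. -/
def DependsOnlyOn (H : LieSubalgebra ℝ L) (F : Module.Dual ℝ L → ℝ) : Prop :=
  ∀ x y : Module.Dual ℝ L, (∀ Y ∈ H, x Y = y Y) → F x = F y

/-- The functions `F i` are functionally independent: their differentials are linearly independent
at all points of a dense subset of `L*`. -/
def FunctionallyIndependent {ι : Type*} (F : ι → Module.Dual ℝ L → ℝ) : Prop :=
  Dense {y | LinearIndependent ℝ fun i => fun v : Module.Dual ℝ L =>
    lineDeriv ℝ (F i) (dualCoord L y) v}

/-- The number `l'`: the maximal number of functionally independent invariants of `L` that depend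
only on the variables of the subalgebra `H`. -/
def numCommonInvariants (H : LieSubalgebra ℝ L) : ℕ :=
  sSup {k : ℕ | ∃ F : Fin k → Module.Dual ℝ L → ℝ,
    (∀ i, IsSmooth (F i) ∧ IsInvariant (F i) ∧ DependsOnlyOn H (F i)) ∧
    FunctionallyIndependent F}

/-- The number `m = 2n = dim L - 𝒩(L) - dim H - 𝒩(H) + 2 l'` of available missing label operators
of the chain `L ⊃ H`. -/
def numLabelling (H : LieSubalgebra ℝ L) : ℤ :=
  (Module.finrank ℝ L : ℤ) - numInvariants L - Module.finrank ℝ H - numInvariants H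
    + 2 * numCommonInvariants H

/-- `L` is a completely reducible representation of its subalgebra `H`: every `H`-stable subspace
has an `H`-stable complement. -/
def IsCompletelyReducible (H : LieSubalgebra ℝ L) : Prop :=
  ComplementedLattice (LieSubmodule ℝ H L)

end Invariants

section Contraction

variable {V : Type*} [AddCommGroup V] [Module ℝ V]

/-- The diagonal map `Xⱼ ↦ t ^ nⱼ • Xⱼ` in the basis `X`. -/
def diagMap {ι : Type*} (X : Module.Basis ι ℝ V) (n : ι → ℤ) (t : ℝ) : V →ₗ[ℝ] V :=
  X.constr ℝ fun j => t ^ n j • X j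

/-- For `t ≠ 0`, the map with exponents `-nⱼ` is the inverse of the one with exponents `nⱼ`. -/
theorem diagMap_neg_diagMap {ι : Type*} (X : Module.Basis ι ℝ V) (n : ι → ℤ) {t : ℝ}
    (ht : t ≠ 0) (v : V) : diagMap X (fun j => -n j) t (diagMap X n t v) = v := by
  have h : diagMap X (fun j => -n j) t ∘ₗ diagMap X n t = LinearMap.id := by
    refine X.ext fun j => ?_
    have hj : t ^ n j * (t ^ n j)⁻¹ = 1 := mul_inv_cancel₀ (zpow_ne_zero _ ht)
    simp [diagMap, Module.Basis.constr_basis, smul_smul, hj]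
  exact LinearMap.congr_fun h v

variable (s : Type*) [LieRing s] [LieAlgebra ℝ s] (g : Type*) [LieRing g] [LieAlgebra ℝ g]

/-- A generalized Inönü–Wigner contraction `s ⇝ g`: for `Φ_t` diagonal, with entries `t ^ nⱼ`, in
some basis of `s`, the brackets `Φ_t⁻¹ ⁅Φ_t Y, Φ_t Z⁆` converge for `t → ∞`, and the vector space
`s` with the limit bracket is the Lie algebra `g` (identified with `s` as a vector space by
`toLinearEquiv`). Convergence is that of all coordinates. -/
structure Contraction where
  basis : Module.Basis (Fin (Module.finrank ℝ s)) ℝ s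
  exponent : Fin (Module.finrank ℝ s) → ℤ
  toLinearEquiv : s ≃ₗ[ℝ] g
  tendsto_bracket : ∀ (Y Z : s) (k : Fin (Module.finrank ℝ s)),
    Filter.Tendsto
      (fun t : ℝ => basis.repr (diagMap basis (fun j => -exponent j) t
        ⁅diagMap basis exponent t Y, diagMap basis exponent t Z⁆) k)
      Filter.atTop
      (nhds (basis.repr (toLinearEquiv.symm ⁅toLinearEquiv Y, toLinearEquiv Z⁆) k))

variable {s g}

namespace Contraction

/-- The map `Φ_t` of the contraction. -/
def phi (c : Contraction s g) (t : ℝ) : s →ₗ[ℝ] s :=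
  diagMap c.basis c.exponent t

/-- The subalgebra `s'` remains invariant: it is fixed by all the maps `Φ_t`. -/
def Fixes (c : Contraction s g) (s' : LieSubalgebra ℝ s) : Prop :=
  ∀ t : ℝ, 1 ≤ t → ∀ Y ∈ s', c.phi t Y = Y

/-- The maps `Φ_t` are endomorphisms of the representation of `s'` on `s`. -/
def Commutes (c : Contraction s g) (s' : LieSubalgebra ℝ s) : Prop :=
  ∀ t : ℝ, 1 ≤ t → ∀ Y ∈ s', ∀ Z : s, c.phi t ⁅Y, Z⁆ = ⁅Y, c.phi t Z⁆

/-- The bracket of an invariant subalgebra is not changed by the contraction. -/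
theorem Fixes.map_lie {c : Contraction s g} {s' : LieSubalgebra ℝ s} (h : c.Fixes s')
    {Y Z : s} (hY : Y ∈ s') (hZ : Z ∈ s') :
    c.toLinearEquiv ⁅Y, Z⁆ = ⁅c.toLinearEquiv Y, c.toLinearEquiv Z⁆ := by
  rw [← LinearEquiv.eq_symm_apply]
  refine c.basis.repr.injective (Finsupp.ext fun k => ?_)
  refine tendsto_nhds_unique (Filter.Tendsto.congr' ?_ tendsto_const_nhds)
    (c.tendsto_bracket Y Z k)
  filter_upwards [Filter.eventually_ge_atTop (1 : ℝ)] with t ht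
  have e1 : diagMap c.basis c.exponent t Y = Y := h t ht Y hY
  have e2 : diagMap c.basis c.exponent t Z = Z := h t ht Z hZ
  have e3 : diagMap c.basis c.exponent t ⁅Y, Z⁆ = ⁅Y, Z⁆ := h t ht _ (s'.lie_mem hY hZ)
  have e4 := diagMap_neg_diagMap c.basis c.exponent (t := t) (by positivity) ⁅Y, Z⁆
  rw [e3] at e4
  rw [e1, e2, e4]

/-- An invariant subalgebra `s'` of `s`, as a subalgebra of the contraction `g`. -/
def image (c : Contraction s g) (s' : LieSubalgebra ℝ s) (h : c.Fixes s') :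
    LieSubalgebra ℝ g :=
  { s'.toSubmodule.map c.toLinearEquiv.toLinearMap with
    lie_mem' := by
      rintro _ _ ⟨Y, hY, rfl⟩ ⟨Z, hZ, rfl⟩
      exact ⟨⁅Y, Z⁆, s'.lie_mem hY hZ, h.map_lie hY hZ⟩ }

end Contraction

end Contraction

end

end LieLabelling

/-! Expanding $m$ and $\widetilde m$, equation (a) says that $\mathcal N(\mathfrak s')$, the
dimensions and $l'$ agree for both chains. Only $l'$ needs an argument. The differential of a
function of the variables of $H$ sees only the restriction to $H$ of the direction $Y\mapsto
x[X,Y]$, so invariance involves brackets of $H$ with $L$ but none inside a complement of $H$. Hence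
$l'$ is preserved by any isomorphism of $H$-modules $\mathfrak s\to\mathfrak g$ that restricts to an
isomorphism of the subalgebras (`IsIntertwiner`). If the $\Phi_t$ commute with
$\operatorname{ad}\mathfrak s'$, the identification of vector spaces is one. In general, as an
$\mathfrak s'$-module, $\mathfrak g$ is the associated graded of the filtration of $\mathfrak s$ by
exponents, and complete reducibility splits this filtration.

Given (a), (b) says that $\widetilde m\ge0$. Complete reducibility passes to $\mathfrak g$, so it
suffices that $m\ge 0$ for every completely reducible $L\supset H$. A rank inequality for
alternating forms (`two_mul_finrank_le_of_skew`) reduces this to one point $x\in L^*$ whose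
stabilizer in $H$ has dimension at most $l'$.

Write $L=H\oplus W$ as $H$-modules, $H=S\oplus Z(H)$ with $S$ semisimple, and let $I$ be the kernel
of $H$ on $W$. Take $x=(y,w)$ with $y$ the Killing dual of a regular $e\in S$ and $w$ generic: the
stabilizer lies in the sum of the centralizer of $e$ in $I\cap S$ and $I\cap Z(H)$
(`exists_generic_stabilizer`). Conversely $L$ acts on $I$ through $H$, so the trace polynomials of
$I\cap S$ and the linear functions given by $I\cap Z(H)$ are common invariants. Their differentials
at a suitable point have at least that rank (`finrank_add_finrank_le_numCommonInvariants`). -/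

namespace LieLabelling

/-! ### Transport along isomorphisms of modules over the subalgebra -/

section Transport

variable {L₁ L₂ : Type*} [LieRing L₁] [LieAlgebra ℝ L₁] [LieRing L₂] [LieAlgebra ℝ L₂]

/-- A linear isomorphism of Lie algebras that restricts to an isomorphism of the subalgebras `H₁`
and `H₂` and intertwines their adjoint actions. -/
structure IsIntertwiner (H₁ : LieSubalgebra ℝ L₁) (H₂ : LieSubalgebra ℝ L₂)
    (e : L₁ ≃ₗ[ℝ] L₂) : Prop where
  mem_iff : ∀ Y, e Y ∈ H₂ ↔ Y ∈ H₁
  map_lie : ∀ Y ∈ H₁, ∀ Z, e ⁅Y, Z⁆ = ⁅e Y, e Z⁆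

namespace IsIntertwiner

variable {H₁ : LieSubalgebra ℝ L₁} {H₂ : LieSubalgebra ℝ L₂} {e : L₁ ≃ₗ[ℝ] L₂}

theorem symm (h : IsIntertwiner H₁ H₂ e) : IsIntertwiner H₂ H₁ e.symm where
  mem_iff Y := by rw [← h.mem_iff, e.apply_symm_apply]
  map_lie Y hY Z := by
    apply e.injective
    rw [h.map_lie _ (by rwa [← h.mem_iff, e.apply_symm_apply])]
    simp

/-- The isomorphism of the subalgebras given by an intertwiner. -/
noncomputable def lieEquiv (h : IsIntertwiner H₁ H₂ e) : H₁ ≃ₗ⁅ℝ⁆ H₂ :=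
  { toFun := fun Y => ⟨e Y, (h.mem_iff Y).2 Y.2⟩
    invFun := fun Y => ⟨e.symm Y, (h.symm.mem_iff Y).2 Y.2⟩
    left_inv := fun Y => by simp
    right_inv := fun Y => by simp
    map_add' := fun Y Z => by ext; simp
    map_smul' := fun r Y => by ext; simp
    map_lie' := fun {Y Z} => by ext; simp [h.map_lie Y Y.2] }

theorem isCompletelyReducible (h : IsIntertwiner H₁ H₂ e) (h₁ : IsCompletelyReducible H₁) :
    IsCompletelyReducible H₂ := by
  have : ComplementedLattice (LieSubmodule ℝ H₁ L₁) := h₁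
  refine ⟨fun N => ?_⟩
  let N' : LieSubmodule ℝ H₁ L₁ :=
    { N.toSubmodule.comap e.toLinearMap with
      lie_mem := fun {Y Z} hZ => by
        have : e ⁅Y, Z⁆ ∈ N := by
          rw [show e ⁅Y, Z⁆ = ⁅h.lieEquiv Y, e Z⁆ from h.map_lie Y Y.2 Z]
          exact N.lie_mem hZ
        exact this }
  obtain ⟨C, hC⟩ := exists_isCompl N'
  let C' : LieSubmodule ℝ H₂ L₂ :=
    { C.toSubmodule.comap e.symm.toLinearMap with
      lie_mem := fun {Y Z} hZ => by
        have : e.symm ⁅Y, Z⁆ ∈ C := by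
          rw [show e.symm ⁅Y, Z⁆ = ⁅h.symm.lieEquiv Y, e.symm Z⁆ from h.symm.map_lie Y Y.2 Z]
          exact C.lie_mem hZ
        exact this }
  refine ⟨C', ?_⟩
  rw [← LieSubmodule.isCompl_toSubmodule] at hC ⊢
  have hN : N.toSubmodule = N'.toSubmodule.map e.toLinearMap := by
    ext Z
    simp only [Submodule.mem_map]
    refine ⟨fun hZ => ⟨e.symm Z, ?_, by simp⟩, ?_⟩
    · change e (e.symm Z) ∈ N
      simpa using hZ
    · rintro ⟨Y, hY, rfl⟩
      exact hY
  have hC' : C'.toSubmodule = C.toSubmodule.map e.toLinearMap := by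
    ext Z
    simp only [Submodule.mem_map]
    refine ⟨fun hZ => ⟨e.symm Z, hZ, by simp⟩, ?_⟩
    rintro ⟨Y, hY, rfl⟩
    change e.symm (e Y) ∈ C
    simpa using hY
  rw [hN, hC']
  exact (Submodule.orderIsoMapComap e).isCompl hC

end IsIntertwiner

theorem commutatorRank_le_of_lieEquiv (e : L₁ ≃ₗ⁅ℝ⁆ L₂) [FiniteDimensional ℝ L₂] :
    commutatorRank L₁ ≤ commutatorRank L₂ := by
  refine ciSup_le fun x => ?_
  have hb : BddAbove (Set.range fun x : Module.Dual ℝ L₂ =>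
      Module.finrank ℝ (LinearMap.range (commutatorForm L₂ x))) := by
    refine ⟨Module.finrank ℝ L₂, ?_⟩
    rintro _ ⟨x, rfl⟩
    exact LinearMap.finrank_range_le _
  refine le_trans ?_ (le_ciSup hb (x ∘ₗ e.symm.toLinearEquiv.toLinearMap))
  have h : commutatorForm L₁ x = e.toLinearEquiv.dualMap.toLinearMap ∘ₗ
      commutatorForm L₂ (x ∘ₗ e.symm.toLinearEquiv.toLinearMap) ∘ₗ
        e.toLinearEquiv.toLinearMap := by
    ext Y Z
    have : e.symm ⁅e Y, e Z⁆ = ⁅Y, Z⁆ := by rw [← LieEquiv.map_lie, LieEquiv.symm_apply_apply]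
    change x ⁅Y, Z⁆ = x (e.symm ⁅e Y, e Z⁆)
    rw [this]
  rw [h, LinearMap.range_comp, LinearMap.range_comp, LinearEquiv.range, Submodule.map_top]
  exact (LinearEquiv.finrank_map_eq e.toLinearEquiv.dualMap _).le

theorem numInvariants_eq_of_lieEquiv [FiniteDimensional ℝ L₁] [FiniteDimensional ℝ L₂]
    (e : L₁ ≃ₗ⁅ℝ⁆ L₂) : numInvariants L₁ = numInvariants L₂ := by
  rw [numInvariants, numInvariants, e.toLinearEquiv.finrank_eq,
    le_antisymm (commutatorRank_le_of_lieEquiv e) (commutatorRank_le_of_lieEquiv e.symm)]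

variable {H₁ : LieSubalgebra ℝ L₁} {H₂ : LieSubalgebra ℝ L₂} {e : L₁ ≃ₗ[ℝ] L₂}

theorem DependsOnlyOn.lineDeriv_congr {F : Module.Dual ℝ L₁ → ℝ} (hF : DependsOnlyOn H₁ F)
    (x : Module.Dual ℝ L₁) {v w : Module.Dual ℝ L₁} (h : ∀ Y ∈ H₁, v Y = w Y) :
    lineDeriv ℝ F x v = lineDeriv ℝ F x w := by
  simp only [lineDeriv]
  congr 1
  ext t
  exact hF _ _ fun Y hY => by simp [h Y hY]

theorem lineDeriv_comp_dualMap (F : Module.Dual ℝ L₁ → ℝ) (e : L₁ →ₗ[ℝ] L₂)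
    (x v : Module.Dual ℝ L₂) :
    lineDeriv ℝ (fun x => F (e.dualMap x)) x v = lineDeriv ℝ F (e.dualMap x) (e.dualMap v) := by
  simp [lineDeriv]

theorem DependsOnlyOn.comp_dualMap {F : Module.Dual ℝ L₁ → ℝ}
    (hD : DependsOnlyOn H₁ F) (h : IsIntertwiner H₁ H₂ e) :
    DependsOnlyOn H₂ fun x : Module.Dual ℝ L₂ => F (e.toLinearMap.dualMap x) :=
  fun _ _ hxy => hD _ _ fun Y hY => hxy (e Y) ((h.mem_iff Y).2 hY)

/-- Although `e` need not preserve brackets outside the subalgebra, the derivative of `F` sees a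
direction only through its values on `H₁`, where just the intertwined action enters. -/
theorem IsInvariant.comp_dualMap {F : Module.Dual ℝ L₁ → ℝ} (hF : IsInvariant F)
    (hD : DependsOnlyOn H₁ F) (h : IsIntertwiner H₁ H₂ e) :
    IsInvariant fun x : Module.Dual ℝ L₂ => F (e.toLinearMap.dualMap x) := by
  intro X x
  rw [lineDeriv_comp_dualMap, ← hF (e.symm X) (e.toLinearMap.dualMap x)]
  refine hD.lineDeriv_congr _ fun Y hY => ?_
  change x ⁅X, e Y⁆ = x (e ⁅e.symm X, Y⁆)
  rw [← lie_skew X, ← lie_skew (e.symm X), map_neg, map_neg, map_neg, h.map_lie Y hY,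
    e.apply_symm_apply]

variable [FiniteDimensional ℝ L₁] [FiniteDimensional ℝ L₂]

theorem IsSmooth.comp_dualMap {F : Module.Dual ℝ L₁ → ℝ} (hF : IsSmooth F) (e : L₁ →ₗ[ℝ] L₂) :
    IsSmooth fun x : Module.Dual ℝ L₂ => F (e.dualMap x) := by
  let A := (dualCoord L₁).symm.toLinearMap ∘ₗ e.dualMap ∘ₗ (dualCoord L₂).toLinearMap
  have h : ContDiff ℝ ∞ fun y => F (dualCoord L₁ (A.toContinuousLinearMap y)) :=
    ContDiff.comp (g := fun y => F (dualCoord L₁ y)) hF A.toContinuousLinearMap.contDiff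
  simpa [A, IsSmooth] using h

theorem FunctionallyIndependent.comp_dualMap {ι : Type*} {F : ι → Module.Dual ℝ L₁ → ℝ}
    (hF : FunctionallyIndependent F) (e : L₁ ≃ₗ[ℝ] L₂) :
    FunctionallyIndependent fun i (x : Module.Dual ℝ L₂) => F i (e.toLinearMap.dualMap x) := by
  let A := (dualCoord L₂) ≪≫ₗ e.dualMap ≪≫ₗ (dualCoord L₁).symm
  have hA : IsOpenMap A := A.toContinuousLinearEquiv.toHomeomorph.isOpenMap
  refine (Dense.preimage hF hA).mono fun y hy => ?_
  have hy' : LinearIndependent ℝ fun i => fun v : Module.Dual ℝ L₁ =>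
      lineDeriv ℝ (F i) (e.toLinearMap.dualMap (dualCoord L₂ y)) v := by
    simpa [A, LinearEquiv.dualMap] using hy
  have := hy'.map' (LinearMap.funLeft ℝ ℝ e.toLinearMap.dualMap)
    (LinearMap.ker_eq_bot.2 (LinearMap.funLeft_injective_of_surjective ℝ ℝ _ e.dualMap.surjective))
  simp only [Set.mem_ofPred_eq, lineDeriv_comp_dualMap]
  exact this

theorem IsIntertwiner.exists_invariants (h : IsIntertwiner H₁ H₂ e) {k : ℕ}
    (hk : ∃ F : Fin k → Module.Dual ℝ L₁ → ℝ,
      (∀ i, IsSmooth (F i) ∧ IsInvariant (F i) ∧ DependsOnlyOn H₁ (F i)) ∧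
      FunctionallyIndependent F) :
    ∃ F : Fin k → Module.Dual ℝ L₂ → ℝ,
      (∀ i, IsSmooth (F i) ∧ IsInvariant (F i) ∧ DependsOnlyOn H₂ (F i)) ∧
      FunctionallyIndependent F := by
  obtain ⟨F, hF, hI⟩ := hk
  exact ⟨fun i x => F i (e.toLinearMap.dualMap x), fun i =>
    ⟨(hF i).1.comp_dualMap e.toLinearMap, (hF i).2.1.comp_dualMap (hF i).2.2 h,
      (hF i).2.2.comp_dualMap h⟩, hI.comp_dualMap e⟩

theorem IsIntertwiner.numCommonInvariants_eq (h : IsIntertwiner H₁ H₂ e) :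
    numCommonInvariants H₁ = numCommonInvariants H₂ := by
  unfold numCommonInvariants
  congr 1
  ext k
  exact ⟨h.exists_invariants, h.symm.exists_invariants⟩

end Transport

/-! ### The contraction as associated graded module -/

namespace Contraction

variable {s : Type*} [LieRing s] [LieAlgebra ℝ s] {g : Type*} [LieRing g] [LieAlgebra ℝ g]

theorem repr_diagMap {V ι : Type*} [AddCommGroup V] [Module ℝ V] (X : Module.Basis ι ℝ V)
    (n : ι → ℤ) (t : ℝ) (v : V) (k : ι) :
    X.repr (diagMap X n t v) k = t ^ n k * X.repr v k := by
  have h : X.coord k ∘ₗ diagMap X n t = (t ^ n k) • X.coord k := by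
    refine X.ext fun j => ?_
    by_cases hj : j = k
    · subst hj; simp [diagMap, Module.Basis.constr_basis]
    · simp [diagMap, Module.Basis.constr_basis, hj]
  exact LinearMap.congr_fun h v

theorem isIntertwiner_of_commutes (c : Contraction s g) (s' : LieSubalgebra ℝ s)
    (hs' : c.Fixes s') (hc : c.Commutes s') :
    IsIntertwiner s' (c.image s' hs') c.toLinearEquiv where
  mem_iff Y := by
    refine ⟨?_, fun hY => ⟨Y, hY, rfl⟩⟩
    rintro ⟨Z, hZ, h⟩
    rwa [← c.toLinearEquiv.injective h]
  map_lie Y hY Z := by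
    rw [← LinearEquiv.eq_symm_apply]
    refine c.basis.repr.injective (Finsupp.ext fun k => ?_)
    refine tendsto_nhds_unique (Filter.Tendsto.congr' ?_ tendsto_const_nhds)
      (c.tendsto_bracket Y Z k)
    filter_upwards [Filter.eventually_ge_atTop (1 : ℝ)] with t ht
    have e1 : diagMap c.basis c.exponent t Y = Y := hs' t ht Y hY
    have e2 : diagMap c.basis c.exponent t ⁅Y, Z⁆ = ⁅Y, diagMap c.basis c.exponent t Z⁆ :=
      hc t ht Y hY Z
    rw [e1, ← e2, diagMap_neg_diagMap c.basis c.exponent (by positivity)]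

section Filtration

variable (c : Contraction s g) (s' : LieSubalgebra ℝ s)

theorem repr_eq_zero_of_fixes (hs' : c.Fixes s') {Y : s} (hY : Y ∈ s') {k : Fin (Module.finrank ℝ s)}
    (hk : c.exponent k ≠ 0) : c.basis.repr Y k = 0 := by
  have h := congrArg (fun Z => c.basis.repr Z k) (hs' 2 one_le_two Y hY)
  simp only [phi, repr_diagMap] at h
  have h2 : (2 : ℝ) ^ c.exponent k ≠ 1 := by
    rw [Ne, zpow_eq_one_iff_right₀ (by norm_num) (by norm_num)]
    exact hk
  have h3 : ((2 : ℝ) ^ c.exponent k - 1) * c.basis.repr Y k = 0 := by linear_combination h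
  exact (mul_eq_zero.1 h3).resolve_left (sub_ne_zero.2 h2)

/-- As `Y` is fixed, conjugation by $\Phi_t$ only rescales each matrix entry of `ad Y` by a power of
`t`. Convergence then makes the matrix block triangular with respect to the exponents. -/
theorem tendsto_coeff (hs' : c.Fixes s') {Y : s} (hY : Y ∈ s') (j k : Fin (Module.finrank ℝ s)) :
    Filter.Tendsto
      (fun t : ℝ => t ^ (c.exponent j - c.exponent k) * c.basis.repr ⁅Y, c.basis j⁆ k)
      Filter.atTop
      (nhds (c.basis.repr
        (c.toLinearEquiv.symm ⁅c.toLinearEquiv Y, c.toLinearEquiv (c.basis j)⁆) k)) := by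
  refine (c.tendsto_bracket Y (c.basis j) k).congr' ?_
  filter_upwards [Filter.eventually_ge_atTop (1 : ℝ)] with t ht
  have e1 : diagMap c.basis c.exponent t Y = Y := hs' t ht Y hY
  have e2 : diagMap c.basis c.exponent t (c.basis j) = t ^ c.exponent j • c.basis j := by
    simp [diagMap]
  have ht0 : t ≠ 0 := by positivity
  rw [e1, e2, repr_diagMap, lie_smul, map_smul, Finsupp.smul_apply, smul_eq_mul, ← mul_assoc,
    ← zpow_add₀ ht0]
  congr 2
  ring

theorem coeff_eq_zero_of_lt (hs' : c.Fixes s') {Y : s} (hY : Y ∈ s') {j k : Fin (Module.finrank ℝ s)}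
    (h : c.exponent k < c.exponent j) : c.basis.repr ⁅Y, c.basis j⁆ k = 0 := by
  by_contra ha
  have h1 := c.tendsto_coeff s' hs' hY j k
  have h2 : Filter.Tendsto (fun t : ℝ => t ^ (c.exponent j - c.exponent k)) Filter.atTop
      Filter.atTop := by
    obtain ⟨m, hm⟩ := Int.eq_ofNat_of_zero_le (a := c.exponent j - c.exponent k) (by lia)
    simp only [hm, zpow_natCast]
    exact Filter.tendsto_pow_atTop (by lia)
  have h3 := h1.mul_const (c.basis.repr ⁅Y, c.basis j⁆ k)⁻¹
  simp only [mul_assoc, mul_inv_cancel₀ ha, mul_one] at h3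
  exact not_tendsto_nhds_of_tendsto_atTop h2 _ h3

/-- In the limit only the block diagonal part survives, which is the action on the associated graded
of the exponent filtration. -/
theorem coeff_contraction (hs' : c.Fixes s') {Y : s} (hY : Y ∈ s') (j k : Fin (Module.finrank ℝ s)) :
    c.basis.repr (c.toLinearEquiv.symm ⁅c.toLinearEquiv Y, c.toLinearEquiv (c.basis j)⁆) k =
      if c.exponent j = c.exponent k then c.basis.repr ⁅Y, c.basis j⁆ k else 0 := by
  have h1 := c.tendsto_coeff s' hs' hY j k
  rcases lt_trichotomy (c.exponent j) (c.exponent k) with h | h | h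
  · rw [if_neg h.ne]
    refine tendsto_nhds_unique h1 ?_
    have h2 : Filter.Tendsto (fun t : ℝ => t ^ (c.exponent j - c.exponent k)) Filter.atTop
      (nhds 0) := tendsto_zpow_atTop_zero (by lia)
    simpa using h2.mul_const (c.basis.repr ⁅Y, c.basis j⁆ k)
  · rw [if_pos h]
    refine tendsto_nhds_unique h1 ?_
    simp [h]
  · rw [if_neg h.ne']
    refine tendsto_nhds_unique h1 ?_
    simp [c.coeff_eq_zero_of_lt s' hs' hY h]

theorem repr_apply_eq_sum (f : s →ₗ[ℝ] s) (Z : s) (k : Fin (Module.finrank ℝ s)) :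
    c.basis.repr (f Z) k = ∑ j, c.basis.repr Z j * c.basis.repr (f (c.basis j)) k := by
  conv_lhs => rw [← c.basis.sum_repr Z]
  simp only [map_sum, map_smul, Finsupp.coe_finsetSum, Finset.sum_apply, Finsupp.smul_apply,
    smul_eq_mul]

theorem repr_lie_eq_sum (hs' : c.Fixes s') {Y : s} (hY : Y ∈ s') {Z : s} {k : Fin (Module.finrank ℝ s)}
    (hZ : ∀ j, c.exponent j < c.exponent k → c.basis.repr Z j = 0) :
    c.basis.repr ⁅Y, Z⁆ k = ∑ j, c.basis.repr Z j *
      if c.exponent j = c.exponent k then c.basis.repr ⁅Y, c.basis j⁆ k else 0 := by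
  rw [show ⁅Y, Z⁆ = LieModule.toEnd ℝ s s Y Z from rfl, c.repr_apply_eq_sum]
  refine Finset.sum_congr rfl fun j _ => ?_
  rcases lt_trichotomy (c.exponent j) (c.exponent k) with h | h | h
  · simp [hZ j h]
  · simp [h]
  · simp [h.ne', c.coeff_eq_zero_of_lt s' hs' hY h]

theorem repr_contraction_lie (hs' : c.Fixes s') {Y : s} (hY : Y ∈ s') (Z : s) (k : Fin (Module.finrank ℝ s)) :
    c.basis.repr (c.toLinearEquiv.symm ⁅c.toLinearEquiv Y, c.toLinearEquiv Z⁆) k =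
      ∑ j, c.basis.repr Z j *
        if c.exponent j = c.exponent k then c.basis.repr ⁅Y, c.basis j⁆ k else 0 := by
  let f : s →ₗ[ℝ] s := c.toLinearEquiv.symm.toLinearMap ∘ₗ
    LieModule.toEnd ℝ g g (c.toLinearEquiv Y) ∘ₗ c.toLinearEquiv.toLinearMap
  have := c.repr_apply_eq_sum f Z k
  simp only [f, LinearMap.comp_apply, LinearEquiv.coe_coe, LieModule.toEnd_apply_apply,
    c.coeff_contraction s' hs' hY] at this
  exact this

/-- The subspace spanned by the basis vectors of exponent at least `b`. It is stable under any
subalgebra that is fixed by the contraction. -/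
def filtration (hs' : c.Fixes s') (b : ℤ) : LieSubmodule ℝ s' s where
  carrier := {Z | ∀ k, c.exponent k < b → c.basis.repr Z k = 0}
  add_mem' := fun {Y Z} hY hZ k hk => by simp [hY k hk, hZ k hk]
  zero_mem' := fun k _ => by simp
  smul_mem' := fun r Z hZ k hk => by simp [hZ k hk]
  lie_mem := fun {Y Z} hZ k hk => by
    change c.basis.repr ⁅(Y : s), Z⁆ k = 0
    rw [c.repr_lie_eq_sum s' hs' Y.2 fun j hj => hZ j (hj.trans hk)]
    refine Finset.sum_eq_zero fun j _ => ?_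
    split_ifs with h
    · rw [hZ j (h.trans_lt hk), zero_mul]
    · rw [mul_zero]

theorem mem_filtration (hs' : c.Fixes s') {b : ℤ} {Z : s} :
    Z ∈ c.filtration s' hs' b ↔ ∀ k, c.exponent k < b → c.basis.repr Z k = 0 := Iff.rfl

theorem exists_isCompl_filtration (hs' : c.Fixes s') (hc : IsCompletelyReducible s') (b : ℤ) :
    ∃ D : LieSubmodule ℝ s' s, IsCompl (c.filtration s' hs' b) D ∧
      (0 < b → ∀ Y ∈ s', Y ∈ D) := by
  have : ComplementedLattice (LieSubmodule ℝ s' s) := hc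
  -- Fixed vectors have exponent zero, so for `0 < b` the subalgebra meets the filtration step
  -- trivially and the complement can be chosen to contain it. This is what makes the splitting
  -- below the identity on `s'`.
  by_cases hb : 0 < b
  · have hd : Disjoint s'.toLieSubmodule (c.filtration s' hs' b) := by
      rw [disjoint_iff, LieSubmodule.eq_bot_iff]
      intro Y hY
      rw [LieSubmodule.mem_inf, LieSubalgebra.mem_toLieSubmodule, c.mem_filtration s' hs'] at hY
      refine c.basis.repr.injective (Finsupp.ext fun k => ?_)
      rw [map_zero, Finsupp.zero_apply]
      by_cases hk : c.exponent k = 0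
      · exact hY.2 k (hk.trans_lt hb)
      · exact c.repr_eq_zero_of_fixes s' hs' hY.1 hk
    obtain ⟨D, hD, h⟩ := hd.exists_isCompl
    exact ⟨D, h.symm, fun _ Y hY => hD hY⟩
  · obtain ⟨D, hD⟩ := exists_isCompl (c.filtration s' hs' b)
    exact ⟨D, hD, fun h => absurd h hb⟩

/-- A completely reducible representation is isomorphic to the one on its contraction, by an
isomorphism that is the identity on the fixed subalgebra. -/
theorem exists_isIntertwiner_of_isCompletelyReducible (hs' : c.Fixes s')
    (hc : IsCompletelyReducible s') :
    ∃ e : s ≃ₗ[ℝ] g, IsIntertwiner s' (c.image s' hs') e := by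
  choose D hD hD' using c.exists_isCompl_filtration s' hs' hc
  have hDs (b : ℤ) : IsCompl (c.filtration s' hs' b).toSubmodule (D b).toSubmodule := by
    rw [LieSubmodule.isCompl_toSubmodule]; exact hD b
  let p (b : ℤ) : s →ₗ[ℝ] s := (c.filtration s' hs' b).toSubmodule.projection _ (hDs b)
  have hpF (b : ℤ) (Z : s) : p b Z ∈ c.filtration s' hs' b :=
    Submodule.projection_apply_mem _ _
  have hp_left (b : ℤ) (Z : s) (hZ : Z ∈ c.filtration s' hs' b) : p b Z = Z :=
    Submodule.projection_apply_left (hDs b) ⟨Z, hZ⟩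
  have hp_right (b : ℤ) (Z : s) (hZ : Z ∈ D b) : p b Z = 0 :=
    (Submodule.projection_apply_eq_zero_iff (hDs b)).2 hZ
  have hp_lie (b : ℤ) (Y : s) (hY : Y ∈ s') (Z : s) : p b ⁅Y, Z⁆ = ⁅Y, p b Z⁆ := by
    have h1 : Z - p b Z ∈ D b := Submodule.sub_projection_mem (hDs b) Z
    have h2 := hp_right b _ ((D b).lie_mem (x := ⟨Y, hY⟩) h1)
    have h3 := hp_left b _ ((c.filtration s' hs' b).lie_mem (x := ⟨Y, hY⟩) (hpF b Z))
    change p b ⁅Y, Z - p b Z⁆ = 0 at h2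
    change p b ⁅Y, p b Z⁆ = ⁅Y, p b Z⁆ at h3
    rw [lie_sub, map_sub, h3] at h2
    exact sub_eq_zero.1 h2
  -- The splitting: the coordinate of index `k` is read off after the equivariant projection onto
  -- the filtration step at the exponent of `k`, where lower exponents no longer contribute.
  let f : s →ₗ[ℝ] s := c.basis.equivFun.symm.toLinearMap ∘ₗ
    LinearMap.pi fun k => c.basis.coord k ∘ₗ p (c.exponent k)
  have hf (Z : s) (k : Fin (Module.finrank ℝ s)) :
      c.basis.repr (f Z) k = c.basis.repr (p (c.exponent k) Z) k := by
    change c.basis.equivFun (c.basis.equivFun.symm _) k = _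
    rw [LinearEquiv.apply_symm_apply]
    rfl
  have hf_fixed (Y : s) (hY : Y ∈ s') : f Y = Y := by
    refine c.basis.repr.injective (Finsupp.ext fun k => ?_)
    rw [hf]
    by_cases hk : 0 < c.exponent k
    · rw [hp_right _ _ (hD' _ hk Y hY), map_zero, Finsupp.zero_apply,
        c.repr_eq_zero_of_fixes s' hs' hY hk.ne']
    · rw [hp_left]
      exact fun j hj => c.repr_eq_zero_of_fixes s' hs' hY (by lia)
  have hf_lie (Y : s) (hY : Y ∈ s') (Z : s) :
      f ⁅Y, Z⁆ = c.toLinearEquiv.symm ⁅c.toLinearEquiv Y, c.toLinearEquiv (f Z)⁆ := by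
    refine c.basis.repr.injective (Finsupp.ext fun k => ?_)
    rw [hf, hp_lie _ _ hY, c.repr_lie_eq_sum s' hs' hY (hpF _ Z),
      c.repr_contraction_lie s' hs' hY]
    refine Finset.sum_congr rfl fun j _ => ?_
    split_ifs with h
    · rw [hf, h]
    · simp
  -- At an index of minimal exponent among the nonzero coordinates of `Z`, the projection fixes `Z`,
  -- so `f` keeps that coordinate.
  have hf_inj : Function.Injective f := by
    rw [injective_iff_map_eq_zero]
    intro Z hZ
    by_contra hne
    let K := Finset.univ.filter fun k => c.basis.repr Z k ≠ 0
    have hK : K.Nonempty := by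
      by_contra hK
      rw [Finset.not_nonempty_iff_eq_empty, Finset.filter_eq_empty_iff] at hK
      exact hne (c.basis.repr.injective (Finsupp.ext fun k => by
        simpa using hK (Finset.mem_univ k)))
    obtain ⟨k, hk, hmin⟩ := K.exists_min_image c.exponent hK
    have hZF : Z ∈ c.filtration s' hs' (c.exponent k) := by
      intro j hj
      by_contra hj'
      exact absurd (hmin j (by simp [K, hj'])) (not_le.2 hj)
    have := hf Z k
    rw [hp_left _ _ hZF, hZ] at this
    simp only [K, Finset.mem_filter] at hk
    exact hk.2 (by simpa using this.symm)
  have : FiniteDimensional ℝ s := Module.Finite.of_basis c.basis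
  let e := LinearEquiv.ofInjectiveEndo f hf_inj
  have he (Z : s) : e Z = f Z := rfl
  refine ⟨e ≪≫ₗ c.toLinearEquiv, ⟨fun Y => ?_, fun Y hY Z => ?_⟩⟩
  · refine ⟨?_, fun hY => ⟨Y, hY, ?_⟩⟩
    · rintro ⟨Z, hZ, h⟩
      have h' : f Z = f Y := by
        rw [hf_fixed Z hZ]
        exact c.toLinearEquiv.injective h
      rwa [← hf_inj h']
    · simp [he, hf_fixed Y hY]
  · rw [LinearEquiv.trans_apply, he, hf_lie Y hY, LinearEquiv.apply_symm_apply]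
    simp [he, hf_fixed Y hY]

theorem exists_isIntertwiner (hs' : c.Fixes s') (hc : c.Commutes s' ∨ IsCompletelyReducible s') :
    ∃ e : s ≃ₗ[ℝ] g, IsIntertwiner s' (c.image s' hs') e :=
  hc.elim (fun h => ⟨_, c.isIntertwiner_of_commutes s' hs' h⟩)
    (c.exists_isIntertwiner_of_isCompletelyReducible s' hs')

end Filtration

end Contraction

/-! ### Complete reducibility and reductive Lie algebras -/

section Reductive

variable {K A M M' : Type*} [Field K] [LieRing A] [AddCommGroup M] [Module K M]
  [LieRingModule A M] [AddCommGroup M'] [Module K M'] [LieRingModule A M']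

theorem complementedLattice_of_injective [ComplementedLattice (LieSubmodule K A M)]
    (f : M' →ₗ⁅K,A⁆ M) (hf : Function.Injective f) :
    ComplementedLattice (LieSubmodule K A M') := by
  refine ⟨fun N => ?_⟩
  obtain ⟨C, hC⟩ := exists_isCompl (N.map f)
  refine ⟨C.comap f, ?_, ?_⟩
  · rw [disjoint_iff, LieSubmodule.eq_bot_iff]
    rintro m ⟨hm, hm'⟩
    have h : f m ∈ N.map f ⊓ C := ⟨⟨m, hm, rfl⟩, hm'⟩
    rw [hC.inf_eq_bot, LieSubmodule.mem_bot] at h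
    exact hf (h.trans (map_zero f).symm)
  · rw [codisjoint_iff, eq_top_iff]
    intro m _
    have h : f m ∈ N.map f ⊔ C := by rw [hC.sup_eq_top]; exact LieSubmodule.mem_top _
    obtain ⟨_, ⟨n, hn, rfl⟩, c, hc, h⟩ := (LieSubmodule.mem_sup _ _ _).1 h
    refine (LieSubmodule.mem_sup _ _ _).2 ⟨n, hn, m - n, ?_, by simp⟩
    have h' : f (m - n) = c := by
      rw [map_sub, ← h]; exact add_sub_cancel_left _ _
    rw [LieSubmodule.mem_comap, h']
    exact hc

variable [LieAlgebra K A] [LieModule K A M]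

/-- An ideal that acts nilpotently on a completely reducible module acts trivially. -/
theorem lie_eq_zero_of_isNilpotent_ideal [ComplementedLattice (LieSubmodule K A M)]
    (I : LieIdeal K A) [LieModule.IsNilpotent I M] {x : A} (hx : x ∈ I) (m : M) :
    ⁅x, m⁆ = 0 := by
  -- `I` kills the complement `C`, so `IM = I(IM)`; thus `IM` lies in every term of the lower
  -- central series.
  obtain ⟨C, hC⟩ := exists_isCompl ⁅I, (⊤ : LieSubmodule K A M)⁆
  have h1 : ⁅I, C⁆ = ⊥ := by
    rw [eq_bot_iff, ← hC.inf_eq_bot]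
    exact le_inf (LieSubmodule.mono_lie_right I le_top) (LieSubmodule.lie_le_right C I)
  have h2 : ⁅I, (⊤ : LieSubmodule K A M)⁆ = ⁅I, ⁅I, (⊤ : LieSubmodule K A M)⁆⁆ := by
    conv_lhs => rw [← hC.sup_eq_top, LieSubmodule.lie_sup, h1, sup_bot_eq]
  have h3 (k : ℕ) : ⁅I, (⊤ : LieSubmodule K A M)⁆ ≤ I.lcs M k := by
    induction k with
    | zero => exact le_top
    | succ k ih =>
      rw [LieIdeal.lcs_succ, h2]
      exact LieSubmodule.mono_lie_right I ih
  obtain ⟨k, hk⟩ := (LieModule.isNilpotent_iff K I M).1 inferInstance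
  have h4 := h3 k (LieSubmodule.lie_mem_lie hx (LieSubmodule.mem_top m))
  have h5 : ⁅x, m⁆ ∈ (I.lcs M k).toSubmodule := h4
  rw [LieIdeal.coe_lcs_eq, hk] at h5
  exact h5

theorem lie_le_of_isCompl_center {S : LieIdeal K A} (hS : IsCompl S (LieAlgebra.center K A))
    (I : LieIdeal K A) : ⁅(⊤ : LieIdeal K A), I⁆ ≤ S := by
  have h : ⁅S, LieAlgebra.center K A⁆ = ⊥ := by
    rw [eq_bot_iff, ← hS.inf_eq_bot]
    exact le_inf (LieSubmodule.lie_le_left _ _) (LieSubmodule.lie_le_right _ _)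
  refine (LieSubmodule.mono_lie_right _ le_top).trans ?_
  rw [← hS.sup_eq_top, LieSubmodule.lie_sup]
  refine sup_le (LieSubmodule.lie_le_right _ _) ?_
  rw [hS.sup_eq_top]
  refine le_trans (le_of_eq ?_) bot_le
  rw [eq_bot_iff, LieSubmodule.lie_le_iff]
  intro x _ y hy
  rw [(LieModule.mem_maxTrivSubmodule K A A y).1 hy x]
  exact zero_mem _

section Adjoint

variable [ComplementedLattice (LieIdeal K A)]

theorem lie_top_eq (I : LieIdeal K A) : ⁅(⊤ : LieIdeal K A), I⁆ = ⁅I, I⁆ := by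
  obtain ⟨J, hJ⟩ := exists_isCompl I
  have h : ⁅J, I⁆ = ⊥ := by
    rw [eq_bot_iff, ← hJ.inf_eq_bot]
    exact le_inf (LieSubmodule.lie_le_right I J) (LieSubmodule.lie_le_left J I)
  rw [← hJ.sup_eq_top, LieSubmodule.sup_lie, h, sup_bot_eq]

/-- If `J` is a complement of `⁅I, I⁆`, then $[A, I\cap J]\subset[A,I]\cap J=[I,I]\cap J=0$, so `I ⊓
J` is central. -/
theorem le_lie_sup_center (I : LieIdeal K A) : I ≤ ⁅I, I⁆ ⊔ I ⊓ LieAlgebra.center K A := by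
  obtain ⟨J, hJ⟩ := exists_isCompl ⁅I, I⁆
  have hI : ⁅I, I⁆ ≤ I := LieSubmodule.lie_le_right I I
  have h1 : ⁅(⊤ : LieIdeal K A), I ⊓ J⁆ = ⊥ := by
    rw [eq_bot_iff, ← hJ.inf_eq_bot, ← lie_top_eq]
    exact le_inf (LieSubmodule.mono_lie_right _ inf_le_left)
      ((LieSubmodule.lie_le_right _ _).trans inf_le_right)
  have h2 : I ⊓ J ≤ LieAlgebra.center K A := by
    intro x hx
    rw [LieModule.mem_maxTrivSubmodule]
    intro y
    have := LieSubmodule.lie_mem_lie (LieSubmodule.mem_top (R := K) (L := A) y) hx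
    rwa [h1, LieSubmodule.mem_bot] at this
  calc I = I ⊓ (⁅I, I⁆ ⊔ J) := by rw [hJ.sup_eq_top, inf_top_eq]
    _ = ⁅I, I⁆ ⊔ I ⊓ J := by rw [inf_comm, sup_inf_assoc_of_le _ hI, inf_comm J]
    _ ≤ _ := sup_le_sup_left (le_inf inf_le_left h2) _

/-- An abelian ideal of `S` is an ideal of `A`, since the center acts trivially. By
`le_lie_sup_center` it is central, so it lies in `S ⊓ center = ⊥`. -/
theorem hasTrivialRadical_of_isCompl_center [IsNoetherian K A] {S : LieIdeal K A}
    (hS : IsCompl S (LieAlgebra.center K A)) : LieAlgebra.HasTrivialRadical K S := by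
  rw [LieAlgebra.hasTrivialRadical_iff_no_abelian_ideals]
  intro J hJ
  have hdec (x : A) : ∃ a ∈ S, ∃ z ∈ LieAlgebra.center K A, a + z = x := by
    have : x ∈ S ⊔ LieAlgebra.center K A := by rw [hS.sup_eq_top]; exact LieSubmodule.mem_top x
    exact (LieSubmodule.mem_sup _ _ _).1 this
  let J' : LieIdeal K A :=
    { J.toSubmodule.map S.toSubmodule.subtype with
      lie_mem := by
        rintro x _ ⟨j, hj, rfl⟩
        obtain ⟨a, ha, z, hz, rfl⟩ := hdec x
        refine ⟨⁅(⟨a, ha⟩ : S), j⁆, J.lie_mem hj, ?_⟩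
        have : ⁅z, (j : A)⁆ = 0 := by
          rw [← lie_skew, (LieModule.mem_maxTrivSubmodule K A A z).1 hz j, neg_zero]
        change ⁅a, (j : A)⁆ = ⁅a + z, (j : A)⁆
        rw [add_lie, this, add_zero] }
  have h1 : ⁅J', J'⁆ = ⊥ := by
    rw [eq_bot_iff, LieSubmodule.lie_le_iff]
    rintro _ ⟨i, hi, rfl⟩ _ ⟨j, hj, rfl⟩
    have := congrArg (fun x : J => ((x : S) : A)) (hJ.trivial ⟨i, hi⟩ ⟨j, hj⟩)
    simpa using this
  have h2 : J' ≤ ⊥ := by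
    have h3 := le_lie_sup_center J'
    rw [h1, bot_sup_eq] at h3
    rw [← hS.inf_eq_bot]
    refine le_inf ?_ (h3.trans inf_le_right)
    rintro _ ⟨i, _, rfl⟩
    exact i.2
  rw [LieSubmodule.eq_bot_iff]
  intro j hj
  have h4 : (j : A) ∈ J' := ⟨j, hj, rfl⟩
  exact Subtype.ext ((LieSubmodule.mem_bot _).1 (h2 h4))

/-- In a reductive Lie algebra, an element that acts nilpotently on a completely reducible module
and is orthogonal to the whole algebra for the trace form acts trivially. -/
theorem lie_eq_zero_of_traceForm_eq_zero [CharZero K] [FiniteDimensional K A]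
    [FiniteDimensional K M] [ComplementedLattice (LieSubmodule K A M)] {x : A}
    (hx : IsNilpotent (LieModule.toEnd K A M x))
    (htr : ∀ y, LieModule.traceForm K A M x y = 0) (m : M) : ⁅x, m⁆ = 0 := by
  let R : LieIdeal K A :=
    { LinearMap.ker (LieModule.traceForm K A M) with
      lie_mem := fun {y z} hz => by
        have hz' : ∀ w, LieModule.traceForm K A M z w = 0 := LinearMap.congr_fun hz
        change LieModule.traceForm K A M ⁅y, z⁆ = 0
        ext w
        rw [← lie_skew, map_neg, LinearMap.neg_apply, LieModule.traceForm_apply_lie_apply, hz',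
          neg_zero, LinearMap.zero_apply] }
  have hxR : x ∈ R := LinearMap.ext htr
  have hR0 : LieModule.traceForm K R M = 0 := by
    ext y z
    exact LinearMap.congr_fun y.2 (z : A)
  -- Cartan's criterion on the radical `R` of the trace form: `⁅R, R⁆` acts nilpotently, hence
  -- trivially by complete reducibility. Since `⁅A, R⁆ = ⁅R, R⁆`, the action of `x` is `A`-linear.
  have hnil := LieModule.isNilpotent_derivedSeries_of_traceForm_eq_zero hR0
  rw [LieModule.isNilpotent_iff_forall' (R := K)] at hnil
  have hRR : LieModule.IsNilpotent (⁅R, R⁆ : LieIdeal K A) M := by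
    rw [LieModule.isNilpotent_iff_forall' (R := K)]
    rintro ⟨y, hy⟩
    refine hnil ⟨⟨y, LieSubmodule.lie_le_right R R hy⟩, ?_⟩
    rw [LieIdeal.derivedSeries_eq_derivedSeriesOfIdeal_comap, LieIdeal.mem_comap]
    exact hy
  have hcomm (y : A) (m : M) : ⁅y, ⁅x, m⁆⁆ = ⁅x, ⁅y, m⁆⁆ := by
    have h : ⁅y, x⁆ ∈ ⁅R, R⁆ := by
      rw [← lie_top_eq]
      exact LieSubmodule.lie_mem_lie (LieSubmodule.mem_top y) hxR
    have h' := lie_eq_zero_of_isNilpotent_ideal ⁅R, R⁆ h m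
    rwa [lie_lie, sub_eq_zero] at h'
  -- The image of `x` is now a submodule and `x` kills its complement, so `x` and its square have
  -- the same image; nilpotency makes it zero.
  let P : LieSubmodule K A M :=
    { LinearMap.range (LieModule.toEnd K A M x) with
      lie_mem := by
        rintro y _ ⟨m, rfl⟩
        exact ⟨⁅y, m⁆, (hcomm y m).symm⟩ }
  obtain ⟨C, hC⟩ := exists_isCompl P
  have hC0 (c : M) (hc : c ∈ C) : ⁅x, c⁆ = 0 := by
    have : ⁅x, c⁆ ∈ P ⊓ C := ⟨⟨c, rfl⟩, C.lie_mem hc⟩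
    rwa [hC.inf_eq_bot, LieSubmodule.mem_bot] at this
  have hsq (m : M) : ∃ n, ⁅x, m⁆ = ⁅x, ⁅x, n⁆⁆ := by
    have : m ∈ P ⊔ C := by rw [hC.sup_eq_top]; exact LieSubmodule.mem_top m
    obtain ⟨_, ⟨n, rfl⟩, c, hc, rfl⟩ := (LieSubmodule.mem_sup _ _ _).1 this
    exact ⟨n, by rw [lie_add, hC0 c hc, add_zero]; rfl⟩
  have hpow (k : ℕ) (m : M) : ∃ n, ⁅x, m⁆ = (LieModule.toEnd K A M x ^ k) ⁅x, n⁆ := by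
    induction k generalizing m with
    | zero => exact ⟨m, rfl⟩
    | succ k ih =>
      obtain ⟨n, hn⟩ := hsq m
      obtain ⟨n', hn'⟩ := ih n
      refine ⟨n', ?_⟩
      rw [hn, hn', pow_succ', Module.End.mul_apply, LieModule.toEnd_apply_apply]
  obtain ⟨k, hk⟩ := hx
  obtain ⟨n, hn⟩ := hpow k m
  rw [hn, hk, LinearMap.zero_apply]

end Adjoint

/-- A Lie algebra with non-degenerate Killing form contains an element with abelian centralizer,
for which the centralizer and the range of the adjoint map span. -/
theorem exists_isLieAbelian_centralizer (K S : Type*) [Field K] [Infinite K] [LieRing S]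
    [LieAlgebra K S] [FiniteDimensional K S] [LieAlgebra.IsKilling K S] :
    ∃ e : S, (∀ a b : S, ⁅e, a⁆ = 0 → ⁅e, b⁆ = 0 → ⁅a, b⁆ = 0) ∧
      ∀ x : S, ∃ a b : S, ⁅e, a⁆ = 0 ∧ a + ⁅e, b⁆ = x := by
  -- The Engel subalgebra of `e` contains the centralizer of `e` and, being a Cartan subalgebra of a
  -- Killing algebra, is abelian.
  obtain ⟨e, he⟩ := LieAlgebra.exists_isCartanSubalgebra_engel K S
  have hab : ∀ a ∈ LieSubalgebra.engel K e, ∀ b ∈ LieSubalgebra.engel K e, ⁅a, b⁆ = 0 := by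
    intro a ha b hb
    have := trivial_lie_zero (LieSubalgebra.engel K e) (LieSubalgebra.engel K e) ⟨a, ha⟩ ⟨b, hb⟩
    simpa using congrArg Subtype.val this
  have hmem : ∀ a, ⁅e, a⁆ = 0 → a ∈ LieSubalgebra.engel K e := fun a ha =>
    (LieSubalgebra.mem_engel_iff K e a).2 ⟨1, by simpa using ha⟩
  refine ⟨e, fun a b ha hb => hab a (hmem a ha) b (hmem b hb), fun x => ?_⟩
  have hd : Disjoint (LinearMap.ker (LieAlgebra.ad K S e))
      (LinearMap.range (LieAlgebra.ad K S e)) := by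
    rw [Submodule.disjoint_def]
    rintro _ h ⟨b, rfl⟩
    have hb : b ∈ LieSubalgebra.engel K e :=
      (LieSubalgebra.mem_engel_iff K e b).2 ⟨2, by simpa [pow_two] using h⟩
    exact hab e (LieSubalgebra.self_mem_engel K e) b hb
  have htop := Submodule.eq_top_of_disjoint _ _
    ((add_comm _ _).trans (LinearMap.finrank_range_add_finrank_ker (LieAlgebra.ad K S e))).ge hd
  have hx : x ∈ LinearMap.ker (LieAlgebra.ad K S e) ⊔ LinearMap.range (LieAlgebra.ad K S e) := by
    rw [htop]; exact Submodule.mem_top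
  obtain ⟨a, ha, _, ⟨b, rfl⟩, h⟩ := Submodule.mem_sup.1 hx
  exact ⟨a, b, ha, h⟩

end Reductive

/-! ### Generic functionals and generic stabilizers -/

section GenericFunctional

/-- If a linear map has maximal rank on a line of linear maps, then the direction of the line maps
its kernel into its range. -/
theorem apply_mem_range_of_finrank_range_add_smul_le {T E : Type*} [AddCommGroup T] [Module ℝ T]
    [AddCommGroup E] [Module ℝ E] [FiniteDimensional ℝ E] (φ ψ : T →ₗ[ℝ] E)
    (h : ∀ t : ℝ, Module.finrank ℝ (LinearMap.range (φ + t • ψ)) ≤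
      Module.finrank ℝ (LinearMap.range φ)) {a : T} (ha : φ a = 0) :
    ψ a ∈ LinearMap.range φ := by
  by_contra hψ
  let β := Module.finBasis ℝ (LinearMap.range φ)
  choose x hx using fun i => (β i).2
  -- Lifts of a basis of the range of `φ`, deformed along the line, together with `ψ a`, which is
  -- the image of `t⁻¹ • a` for `t ≠ 0`. Independence at `t = 0` persists for small `t`, so the rank
  -- would jump.
  let G (t : ℝ) : Fin (Module.finrank ℝ (LinearMap.range φ) + 1) → E :=
    Fin.cons (ψ a) fun i => φ (x i) + t • ψ (x i)
  have h0 : LinearIndependent ℝ (G 0) := by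
    simp only [G, zero_smul, add_zero, hx]
    rw [linearIndependent_finCons]
    refine ⟨β.linearIndependent.map' (LinearMap.range φ).subtype (Submodule.ker_subtype _),
      fun hmem => hψ (Submodule.span_le.2 ?_ hmem)⟩
    rintro _ ⟨i, rfl⟩
    exact (β i).2
  let C := (Module.finBasis ℝ E).equivFun
  have hcont : Continuous fun t i => C (G t i) := by
    refine continuous_pi fun i => ?_
    refine Fin.cases ?_ (fun j => ?_) i
    · simp only [G, Fin.cons_zero]; exact continuous_const
    · simp only [G, Fin.cons_succ, map_add, map_smul]
      exact continuous_const.add (continuous_id.smul continuous_const)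
  have hev := ((isOpen_setOfPred_linearIndependent (𝕜 := ℝ)).preimage hcont).mem_nhds
    (x := (0 : ℝ)) (h0.map' C.toLinearMap C.ker)
  obtain ⟨t, ht, ht0⟩ : ∃ t : ℝ, LinearIndependent ℝ (fun i => C (G t i)) ∧ t ≠ 0 := by
    have h1 : ∀ᶠ t in nhdsWithin (0 : ℝ) {0}ᶜ, LinearIndependent ℝ (fun i => C (G t i)) :=
      nhdsWithin_le_nhds hev
    exact (h1.and eventually_mem_nhdsWithin).exists
  have hG : LinearIndependent ℝ (G t) := LinearIndependent.of_comp C.toLinearMap ht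
  have hmem (i) : G t i ∈ LinearMap.range (φ + t • ψ) := by
    refine Fin.cases ?_ (fun j => ?_) i
    · exact ⟨t⁻¹ • a, by simp [G, ha, ht0]⟩
    · exact ⟨x j, by simp [G]⟩
  let v (i) : LinearMap.range (φ + t • ψ) := ⟨G t i, hmem i⟩
  have hv : LinearIndependent ℝ v :=
    LinearIndependent.of_comp (LinearMap.range (φ + t • ψ)).subtype hG
  have hcard := hv.fintype_card_le_finrank
  rw [Fintype.card_fin] at hcard
  exact absurd (h t) (by lia)

/-- For a generic functional `w`, the elements of a commuting family of endomorphisms that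
annihilate `w` have square zero. -/
theorem exists_dual_forall_sq_eq_zero {T M : Type*} [AddCommGroup T] [Module ℝ T]
    [AddCommGroup M] [Module ℝ M] [FiniteDimensional ℝ M] (φ : T →ₗ[ℝ] Module.End ℝ M)
    (hφ : ∀ a b, Commute (φ a) (φ b)) :
    ∃ w : Module.Dual ℝ M, ∀ a, w ∘ₗ φ a = 0 → φ a ^ 2 = 0 := by
  let Φ (w : Module.Dual ℝ M) : T →ₗ[ℝ] Module.Dual ℝ M := φ.compr₂ w
  have hΦ (w a m) : Φ w a m = w (φ a m) := rfl
  let r (w : Module.Dual ℝ M) : ℕ := Module.finrank ℝ (LinearMap.range (Φ w))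
  -- With the rank maximal at `w`, if `a` annihilates `w` then every $u\circ\varphi(a)$ equals some
  -- $w\circ\varphi(b)$. Commuting `a` past `b` gives $u\,\varphi(a)^2=w\,\varphi(a)\varphi(b)=0$.
  obtain ⟨w, hw⟩ : ∃ w, ∀ u, r u ≤ r w := by
    have hb : BddAbove (Set.range r) :=
      ⟨_, by rintro _ ⟨w, rfl⟩; exact Submodule.finrank_le (LinearMap.range (Φ w))⟩
    obtain ⟨w, hw⟩ := Nat.sSup_mem (Set.range_nonempty r) hb
    exact ⟨w, fun u => hw ▸ le_csSup hb ⟨u, rfl⟩⟩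
  refine ⟨w, fun a ha => LinearMap.ext fun m => ?_⟩
  rw [pow_two, Module.End.mul_apply, LinearMap.zero_apply,
    ← Module.forall_dual_apply_eq_zero_iff ℝ]
  intro u
  have hadd (t : ℝ) : Φ w + t • Φ u = Φ (w + t • u) :=
    LinearMap.ext fun b => LinearMap.ext fun n => by simp [hΦ]
  obtain ⟨b, hb⟩ := apply_mem_range_of_finrank_range_add_smul_le (Φ w) (Φ u)
    (fun t => by rw [hadd]; exact hw _) (a := a) ha
  have h1 : φ b (φ a m) = φ a (φ b m) := LinearMap.congr_fun (hφ b a) m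
  rw [← hΦ, ← hb, hΦ, h1]
  exact LinearMap.congr_fun ha (φ b m)

end GenericFunctional

/-- Existence of a generic point of the coadjoint representation of a reductive Lie algebra `A`
plus the dual of a completely reducible module: its stabilizer acts trivially on the module and
centralizes a regular element of the semisimple part `S` of `A`. -/
theorem exists_generic_stabilizer {A M : Type*} [LieRing A] [LieAlgebra ℝ A]
    [FiniteDimensional ℝ A] [AddCommGroup M] [Module ℝ M] [LieRingModule A M] [LieModule ℝ A M]
    [FiniteDimensional ℝ M] [ComplementedLattice (LieIdeal ℝ A)]
    [ComplementedLattice (LieSubmodule ℝ A M)] {S : LieIdeal ℝ A}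
    (hS : IsCompl S (LieAlgebra.center ℝ A)) [LieAlgebra.IsKilling ℝ S] {e : S}
    (he : ∀ a b : S, ⁅e, a⁆ = 0 → ⁅e, b⁆ = 0 → ⁅a, b⁆ = 0)
    (he' : ∀ x : S, ∃ a b : S, ⁅e, a⁆ = 0 ∧ a + ⁅e, b⁆ = x) :
    ∃ (y : Module.Dual ℝ A) (w : Module.Dual ℝ M), ∀ x : A, (∀ z, y ⁅x, z⁆ = 0) →
      (∀ m, w ⁅x, m⁆ = 0) → (∀ m : M, ⁅x, m⁆ = 0) ∧ ⁅(e : A), x⁆ = 0 := by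
  have hdec (x : A) : ∃ a : S, ∃ z ∈ LieAlgebra.center ℝ A, a + z = x := by
    have : x ∈ S ⊔ LieAlgebra.center ℝ A := by rw [hS.sup_eq_top]; exact LieSubmodule.mem_top x
    obtain ⟨a, ha, z, hz, h⟩ := (LieSubmodule.mem_sup _ _ _).1 this
    exact ⟨⟨a, ha⟩, z, hz, h⟩
  have hz (z : A) (hz : z ∈ LieAlgebra.center ℝ A) (x : A) : ⁅x, z⁆ = 0 :=
    (LieModule.mem_maxTrivSubmodule ℝ A A z).1 hz x
  have hz' (z : A) (hzc : z ∈ LieAlgebra.center ℝ A) (x : A) : ⁅z, x⁆ = 0 := by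
    rw [← lie_skew, hz z hzc, neg_zero]
  have hS' : IsCompl S.toSubmodule (LieAlgebra.center ℝ A).toSubmodule := by
    rwa [LieSubmodule.isCompl_toSubmodule]
  let y : Module.Dual ℝ A := killingForm ℝ S e ∘ₗ Submodule.projectionOnto _ _ hS'
  have hy (a : S) : y a = killingForm ℝ S e a := by
    change killingForm ℝ S e (Submodule.projectionOnto _ _ hS' (a : A)) = _
    rw [Submodule.projectionOnto_apply_left hS' a]
  let T : Submodule ℝ A := LinearMap.ker (LieModule.toEnd ℝ A A e)
  have hT (x : A) : x ∈ T ↔ ⁅(e : A), x⁆ = 0 := Iff.rfl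
  have hTS (a : S) (z : A) (hzc : z ∈ LieAlgebra.center ℝ A) : (a : A) + z ∈ T ↔ ⁅e, a⁆ = 0 := by
    rw [hT, lie_add, hz z hzc, add_zero]
    exact ⟨fun h => Subtype.ext h, fun h => congrArg Subtype.val h⟩
  have hTT (a b : A) (ha : a ∈ T) (hb : b ∈ T) : ⁅a, b⁆ = 0 := by
    obtain ⟨a, z, hzc, rfl⟩ := hdec a
    obtain ⟨b, z', hzc', rfl⟩ := hdec b
    rw [hTS _ _ hzc] at ha
    rw [hTS _ _ hzc'] at hb
    have := congrArg Subtype.val (he a b ha hb)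
    rw [lie_add, hz z' hzc', add_lie, hz' z hzc, add_zero, add_zero]
    exact this
  have hcomm (a b : A) (ha : a ∈ T) (hb : b ∈ T) :
      Commute (LieModule.toEnd ℝ A M a) (LieModule.toEnd ℝ A M b) := by
    refine LinearMap.ext fun m => ?_
    change ⁅a, ⁅b, m⁆⁆ = ⁅b, ⁅a, m⁆⁆
    have := lie_lie a b m
    rw [hTT a b ha hb, zero_lie] at this
    exact sub_eq_zero.1 this.symm
  obtain ⟨w, hw⟩ := exists_dual_forall_sq_eq_zero
    ((LieModule.toEnd ℝ A M : A →ₗ[ℝ] Module.End ℝ M) ∘ₗ T.subtype)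
    fun a b => hcomm a b a.2 b.2
  refine ⟨y, w, fun x hxy hxw => ?_⟩
  have hxT : x ∈ T := by
    obtain ⟨a, z, hzc, rfl⟩ := hdec x
    rw [hTS _ _ hzc, ← Submodule.mem_bot ℝ, ← LieAlgebra.IsKilling.ker_killingForm_eq_bot ℝ S,
      LinearMap.mem_ker]
    ext b
    have hb := hxy b
    rw [add_lie, hz' z hzc, add_zero] at hb
    rw [LieModule.traceForm_apply_lie_apply, LinearMap.zero_apply]
    exact (hy ⁅a, b⁆).symm.trans hb
  have hxnil : IsNilpotent (LieModule.toEnd ℝ A M x) :=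
    ⟨2, hw ⟨x, hxT⟩ (LinearMap.ext hxw)⟩
  -- Modulo the center, `u` is the sum of an element `a` centralizing `e` and a bracket with `e`.
  -- The first part with the center commutes with the nilpotent `x`; the bracket is orthogonal to
  -- `x` because `x` centralizes `e`.
  refine ⟨lie_eq_zero_of_traceForm_eq_zero hxnil fun u => ?_, hxT⟩
  obtain ⟨u, z, hzc, rfl⟩ := hdec u
  obtain ⟨a, b, ha, rfl⟩ := he' u
  have h1 : LieModule.traceForm ℝ A M x (a + z) = 0 := by
    have hc := hcomm x (a + z) hxT ((hTS _ _ hzc).2 ha)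
    exact (LinearMap.isNilpotent_trace_of_isNilpotent (hc.isNilpotent_mul_right hxnil)).eq_zero
  have h2 : LieModule.traceForm ℝ A M x ⁅(e : A), (b : A)⁆ = 0 := by
    rw [← LieModule.traceForm_apply_lie_apply, ← lie_skew, (hT x).1 hxT, neg_zero, map_zero,
      LinearMap.zero_apply]
  have h3 : ((a + ⁅e, b⁆ : S) : A) + z = (a + z) + ⁅(e : A), (b : A)⁆ := by
    change (a : A) + ⁅(e : A), (b : A)⁆ + z = _
    abel
  rw [h3, map_add, h1, h2, add_zero]

/-! ### Traces against powers of a generic element -/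

section PowerTraces

open Module.End Polynomial

/-- `p(g) - p(α)` is a multiple of the nilpotent `g - α` in a commutative setting, so it contributes
no trace. -/
theorem trace_aeval_mul_of_isNilpotent_sub {K U : Type*} [Field K] [AddCommGroup U] [Module K U]
    [FiniteDimensional K U] {g h : Module.End K U} (hgh : Commute g h) {α β : K}
    (hg : IsNilpotent (g - algebraMap K _ α)) (hh : IsNilpotent (h - algebraMap K _ β))
    (p : K[X]) :
    LinearMap.trace K U (aeval g p * h) = Module.finrank K U * (p.eval α * β) := by
  obtain ⟨q, hq⟩ : X - C α ∣ p - C (p.eval α) := X_sub_C_dvd_sub_C_eval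
  have hp : aeval g p = algebraMap K _ (p.eval α) + (g - algebraMap K _ α) * aeval g q := by
    have := congrArg (aeval g) hq
    simp only [map_sub, map_mul, aeval_X, aeval_C] at this
    rw [← this]; abel
  have hgq : Commute (g - algebraMap K _ α) (aeval g q * h) := by
    have h1 : Commute g (aeval g q) := (Algebra.commute_of_mem_adjoin_self
      (aeval_mem_adjoin_singleton K g))
    exact (h1.mul_right hgh).sub_left (Algebra.commutes _ _)
  have h1 : LinearMap.trace K U ((g - algebraMap K _ α) * (aeval g q * h)) = 0 :=
    (LinearMap.isNilpotent_trace_of_isNilpotent (hgq.isNilpotent_mul_right hg)).eq_zero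
  have h2 : LinearMap.trace K U (h - algebraMap K _ β) = 0 :=
    (LinearMap.isNilpotent_trace_of_isNilpotent hh).eq_zero
  have h3 : LinearMap.trace K U h = Module.finrank K U * β := by
    rw [map_sub, sub_eq_zero] at h2
    rw [h2, Algebra.algebraMap_eq_smul_one, map_smul, LinearMap.trace_one, smul_eq_mul, mul_comm]
  rw [hp, add_mul, mul_assoc, map_add, h1, add_zero, Algebra.algebraMap_eq_smul_one, smul_mul_assoc,
    one_mul, map_smul, h3, smul_eq_mul]
  ring

/-- In a real space of commuting complex endomorphisms there is an element `t` such that the traces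
against the powers of `t` determine the traces against the whole space. -/
theorem exists_trace_pow_mul_eq_zero_imp_complex {T V : Type*} [AddCommGroup T] [Module ℝ T]
    [AddCommGroup V] [Module ℂ V] [FiniteDimensional ℂ V] (f : T →ₗ[ℝ] Module.End ℂ V)
    (hf : ∀ a b, Commute (f a) (f b)) :
    ∃ t, ∀ a, (∀ k : ℕ, LinearMap.trace ℂ V (f t ^ k * f a) = 0) →
      ∀ b, LinearMap.trace ℂ V (f b * f a) = 0 := by
  classical
  let N (χ : T → ℂ) : Submodule ℂ V := ⨅ a, (f a).maxGenEigenspace (χ a)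
  have hmaps (a b : T) (μ : ℂ) :
      Set.MapsTo (f a) ((f b).maxGenEigenspace μ) ((f b).maxGenEigenspace μ) :=
    mapsTo_maxGenEigenspace_of_comm (hf b a) μ
  have hind : iSupIndep N := independent_iInf_maxGenEigenspace_of_forall_mapsTo f hmaps
  have htop : ⨆ χ, N χ = ⊤ := iSup_iInf_maxGenEigenspace_eq_top_of_forall_mapsTo f hmaps
    fun a => iSup_maxGenEigenspace_eq_top (f a)
  have hint : DirectSum.IsInternal N :=
    DirectSum.isInternal_submodule_of_iSupIndep_of_iSup_eq_top hind htop
  have hfin : {χ | N χ ≠ ⊥}.Finite := WellFoundedGT.finite_ne_bot_of_iSupIndep hind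
  have hN (a : T) (χ : T → ℂ) : Set.MapsTo (f a) (N χ) (N χ) := by
    intro v hv
    simp only [N, SetLike.mem_coe, Submodule.mem_iInf] at hv ⊢
    exact fun b => hmaps a b _ (hv b)
  let F (χ : T → ℂ) (a : T) : Module.End ℂ (N χ) := (f a).restrict (hN a χ)
  have hFnil (χ : T → ℂ) (a : T) : IsNilpotent (F χ a - algebraMap ℂ _ (χ a)) := by
    have hm : Set.MapsTo (f a - algebraMap ℂ (Module.End ℂ V) (χ a)) (N χ) (N χ) := fun v hv =>
      show f a v - χ a • v ∈ N χ from (N χ).sub_mem (hN a χ hv) ((N χ).smul_mem _ hv)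
    exact isNilpotent_restrict_of_le (p := N χ) (hp := hm) (iInf_le _ a)
      (isNilpotent_restrict_maxGenEigenspace_sub_algebraMap (f a) (χ a))
  have hFcomm (χ : T → ℂ) (a b : T) : Commute (F χ a) (F χ b) :=
    LinearMap.ext fun v => Subtype.ext (LinearMap.congr_fun (hf a b) (v : V))
  have hFpow (χ : T → ℂ) (a : T) (p : ℂ[X]) (v : N χ) :
      (aeval (F χ a) p v : V) = aeval (f a) p (v : V) := by
    induction p using Polynomial.induction_on' with
    | add p q hp hq => simp [hp, hq]
    | monomial k c =>
      have (k : ℕ) : (((F χ a) ^ k) v : V) = ((f a) ^ k) (v : V) := by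
        induction k with
        | zero => rfl
        | succ k ih =>
          rw [pow_succ', pow_succ', Module.End.mul_apply, Module.End.mul_apply, ← ih]; rfl
      simp [aeval_monomial, Module.algebraMap_end_apply, this]
  have htrace (t a : T) (p : ℂ[X]) : LinearMap.trace ℂ V (aeval (f t) p * f a) =
      ∑ χ ∈ hfin.toFinset, Module.finrank ℂ (N χ) * (p.eval (χ t) * χ a) := by
    have hm (χ : T → ℂ) : Set.MapsTo (aeval (f t) p * f a) (N χ) (N χ) := by
      intro v hv
      rw [Module.End.mul_apply]
      have := hFpow χ t p ⟨f a v, hN a χ hv⟩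
      rw [SetLike.mem_coe, ← this]
      exact Submodule.coe_mem _
    rw [LinearMap.trace_eq_sum_trace_restrict' hint hfin hm]
    refine Finset.sum_congr rfl fun χ _ => ?_
    rw [← trace_aeval_mul_of_isNilpotent_sub (hFcomm χ t a) (hFnil χ t) (hFnil χ a)]
    congr 1
    exact LinearMap.ext fun v => Subtype.ext (hFpow χ t p (F χ a v)).symm
  -- A weight is the trace on its weight space divided by the dimension, hence real linear.
  have hlin (χ : T → ℂ) (hχ : N χ ≠ ⊥) : ∃ l : T →ₗ[ℝ] ℂ, ∀ a, l a = χ a := by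
    have hd : (Module.finrank ℂ (N χ) : ℂ) ≠ 0 := by
      rw [Nat.cast_ne_zero]
      exact fun h => hχ (Submodule.finrank_eq_zero.1 h)
    have htr (a : T) : χ a = (Module.finrank ℂ (N χ) : ℂ)⁻¹ * LinearMap.trace ℂ (N χ) (F χ a) := by
      have := trace_aeval_mul_of_isNilpotent_sub (hFcomm χ a a) (hFnil χ a) (hFnil χ a) 1
      rw [map_one, one_mul, eval_one, one_mul] at this
      rw [this, inv_mul_cancel_left₀ hd]
    have hFadd (a b : T) : F χ (a + b) = F χ a + F χ b :=
      LinearMap.ext fun v => Subtype.ext (LinearMap.congr_fun (f.map_add a b) (v : V))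
    have hFsmul (r : ℝ) (a : T) : F χ (r • a) = (r : ℂ) • F χ a :=
      LinearMap.ext fun v => Subtype.ext (LinearMap.congr_fun (f.map_smul r a) (v : V))
    exact ⟨{ toFun := χ
             map_add' := fun a b => by rw [htr, htr a, htr b, hFadd, map_add, mul_add]
             map_smul' := fun r a => by
              rw [htr, htr a, hFsmul, map_smul, RingHom.id_apply, Complex.real_smul, smul_eq_mul]
              ring }, fun _ => rfl⟩
  choose! l hl using hlin
  have hl' (χ) (h : χ ∈ hfin.toFinset) (a : T) : l χ a = χ a := hl χ (hfin.mem_toFinset.1 h) a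
  let P := (hfin.toFinset ×ˢ hfin.toFinset).filter fun χ => χ.1 ≠ χ.2
  -- Finitely many proper subspaces, the kernels of differences of distinct weights, do not cover
  -- `T`.
  obtain ⟨t, ht⟩ : ∃ t, ∀ χ ∈ hfin.toFinset, ∀ ψ ∈ hfin.toFinset, χ t = ψ t → χ = ψ := by
    have hne : (⊤ : Subspace ℝ T) ∉ P.image fun χ => LinearMap.ker (l χ.1 - l χ.2) := by
      intro h
      obtain ⟨⟨χ, ψ⟩, hχ, h⟩ := Finset.mem_image.1 h
      simp only [P, Finset.mem_filter, Finset.mem_product] at hχ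
      refine hχ.2 (funext fun a => ?_)
      have : (l χ - l ψ) a = 0 := by
        rw [LinearMap.ker_eq_top.1 h, LinearMap.zero_apply]
      rwa [LinearMap.sub_apply, sub_eq_zero, hl' χ hχ.1.1, hl' ψ hχ.1.2] at this
    obtain ⟨t, ht⟩ := (Set.ne_univ_iff_exists_notMem _).1
      (Subspace.biUnion_ne_univ_of_top_notMem hne)
    refine ⟨t, fun χ hχ ψ hψ h => ?_⟩
    by_contra hne
    refine ht (Set.mem_biUnion (Finset.mem_image_of_mem _ (Finset.mem_filter.2
      ⟨Finset.mk_mem_product hχ hψ, hne⟩)) ?_)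
    change (l χ - l ψ) t = 0
    rw [LinearMap.sub_apply, hl' χ hχ, hl' ψ hψ, h, sub_self]
  refine ⟨t, fun a ha b => ?_⟩
  -- Since `t` separates the weights, Lagrange interpolation gives a polynomial in `f t` with the
  -- same weights as `f b`; the trace formula depends on nothing else.
  obtain ⟨p, hp⟩ : ∃ p : ℂ[X], ∀ χ : hfin.toFinset, p.eval (χ.1 t) = χ.1 b := by
    rw [Polynomial.exists_eval_eq_iff]
    intro χ ψ h
    rw [ht χ.1 χ.2 ψ.1 ψ.2 h]
  have h1 : LinearMap.trace ℂ V (aeval (f t) p * f a) = 0 := by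
    rw [aeval_eq_sum_range, Finset.sum_mul, map_sum]
    refine Finset.sum_eq_zero fun k _ => ?_
    rw [smul_mul_assoc, map_smul, ha, smul_zero]
  have h2 := htrace b a X
  rw [aeval_X] at h2
  rw [h2, ← h1, htrace]
  refine Finset.sum_congr rfl fun χ hχ => ?_
  rw [hp ⟨χ, hχ⟩, eval_X]

open scoped TensorProduct in
/-- In a space of commuting real endomorphisms there is an element `t` such that the traces
against the powers of `t` determine the traces against the whole space. -/
theorem exists_trace_pow_mul_eq_zero_imp {T V : Type*} [AddCommGroup T] [Module ℝ T]
    [AddCommGroup V] [Module ℝ V] [FiniteDimensional ℝ V] (f : T →ₗ[ℝ] Module.End ℝ V)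
    (hf : ∀ a b, Commute (f a) (f b)) :
    ∃ t, ∀ a, (∀ k : ℕ, LinearMap.trace ℝ V (f t ^ k * f a) = 0) →
      ∀ b, LinearMap.trace ℝ V (f b * f a) = 0 := by
  let B : Module.End ℝ V →ₐ[ℝ] Module.End ℂ (ℂ ⊗[ℝ] V) := Module.End.baseChangeHom ℝ ℂ V
  have hB (g : Module.End ℝ V) : LinearMap.trace ℂ _ (B g) = LinearMap.trace ℝ V g :=
    LinearMap.trace_baseChange g ℂ
  let f' : T →ₗ[ℝ] Module.End ℂ (ℂ ⊗[ℝ] V) :=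
    { toFun := fun a => B (f a)
      map_add' := fun a b => by rw [map_add, map_add]
      map_smul' := fun r a => by
        rw [map_smul, map_smul]
        rfl }
  obtain ⟨t, ht⟩ := exists_trace_pow_mul_eq_zero_imp_complex f' fun a b => (hf a b).map B
  refine ⟨t, fun a ha b => ?_⟩
  have h : LinearMap.trace ℂ _ (B (f b) * B (f a)) = 0 := by
    refine ht a (fun k => ?_) b
    change LinearMap.trace ℂ _ (B (f t) ^ k * B (f a)) = 0
    rw [← map_pow, ← map_mul, hB, ha, Complex.ofReal_zero]
  rw [← map_mul, hB] at h
  exact_mod_cast h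

end PowerTraces

/-! ### Polynomial functions and functional independence -/

section Polynomial

variable (L : Type*) [LieRing L] [LieAlgebra ℝ L]

/-- The polynomial functions on the dual of `L`. -/
def polyFun : Subalgebra ℝ (Module.Dual ℝ L → ℝ) :=
  Algebra.adjoin ℝ (Set.range fun (Z : L) (x : Module.Dual ℝ L) => x Z)

variable {L}

theorem apply_mem_polyFun (Z : L) : (fun x : Module.Dual ℝ L => x Z) ∈ polyFun L :=
  Algebra.subset_adjoin ⟨Z, rfl⟩

theorem exists_hasLineDerivAt_of_mem_polyFun {f : Module.Dual ℝ L → ℝ} (hf : f ∈ polyFun L)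
    (v : Module.Dual ℝ L) :
    ∃ g ∈ polyFun L, ∀ x, HasLineDerivAt ℝ f (g x) x v := by
  induction hf using Algebra.adjoin_induction with
  | mem f hf =>
    obtain ⟨Z, rfl⟩ := hf
    refine ⟨fun _ => v Z, (polyFun L).algebraMap_mem (v Z), fun x => ?_⟩
    have : HasDerivAt (fun t : ℝ => x Z + t * v Z) (v Z) 0 := by
      simpa using ((hasDerivAt_id (0 : ℝ)).mul_const (v Z)).const_add (x Z)
    simpa [HasLineDerivAt] using this
  | algebraMap r =>
    exact ⟨0, (polyFun L).zero_mem, fun x => hasDerivAt_const (0 : ℝ) r⟩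
  | add f₁ f₂ _ _ h₁ h₂ =>
    obtain ⟨g₁, hg₁, h₁⟩ := h₁
    obtain ⟨g₂, hg₂, h₂⟩ := h₂
    exact ⟨g₁ + g₂, (polyFun L).add_mem hg₁ hg₂, fun x => HasDerivAt.add (h₁ x) (h₂ x)⟩
  | mul f₁ f₂ hf₁ hf₂ h₁ h₂ =>
    obtain ⟨g₁, hg₁, h₁⟩ := h₁
    obtain ⟨g₂, hg₂, h₂⟩ := h₂
    refine ⟨g₁ * f₂ + f₁ * g₂, (polyFun L).add_mem ((polyFun L).mul_mem hg₁ hf₂)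
      ((polyFun L).mul_mem hf₁ hg₂), fun x => ?_⟩
    have := HasDerivAt.mul (h₁ x) (h₂ x)
    simpa using! this

theorem lineDeriv_mem_polyFun {f : Module.Dual ℝ L → ℝ} (hf : f ∈ polyFun L)
    (v : Module.Dual ℝ L) : (fun x => lineDeriv ℝ f x v) ∈ polyFun L := by
  obtain ⟨g, hg, h⟩ := exists_hasLineDerivAt_of_mem_polyFun hf v
  rwa [show (fun x => lineDeriv ℝ f x v) = g from funext fun x => (h x).lineDeriv]

variable [FiniteDimensional ℝ L]

theorem linearMap_mem_polyFun (l : Module.Dual ℝ L →ₗ[ℝ] ℝ) : (fun x => l x) ∈ polyFun L := by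
  obtain ⟨Z, rfl⟩ := (Module.evalEquiv ℝ L).surjective l
  exact apply_mem_polyFun Z

theorem trace_pow_mem_polyFun {V : Type*} [AddCommGroup V] [Module ℝ V] [FiniteDimensional ℝ V]
    (D : Module.Dual ℝ L →ₗ[ℝ] Module.End ℝ V) (k : ℕ) :
    (fun x => LinearMap.trace ℝ V (D x ^ k)) ∈ polyFun L := by
  let b := Module.finBasis ℝ V
  let A := LinearMap.toMatrixAlgEquiv b
  have h (i j) : (fun x => (A (D x) ^ k) i j) ∈ polyFun L := by
    induction k generalizing i j with
    | zero => exact (polyFun L).algebraMap_mem ((1 : Matrix _ _ ℝ) i j)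
    | succ k ih =>
      have : (fun x => (A (D x) ^ (k + 1)) i j) =
          ∑ l, (fun x => (A (D x) ^ k) i l) * fun x => A (D x) l j := by
        ext x
        simp [pow_succ, Matrix.mul_apply]
      rw [this]
      exact (polyFun L).sum_mem fun l _ => (polyFun L).mul_mem (ih i l)
        (linearMap_mem_polyFun ((Matrix.entryLinearMap ℝ ℝ l j) ∘ₗ A.toLinearMap ∘ₗ D))
  have hsum : (fun x => LinearMap.trace ℝ V (D x ^ k)) = ∑ i, fun x => (A (D x) ^ k) i i := by
    ext x
    rw [LinearMap.trace_eq_matrix_trace ℝ b, Finset.sum_apply]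
    change Matrix.trace (A (D x ^ k)) = _
    rw [map_pow]
    rfl
  rw [hsum]
  exact (polyFun L).sum_mem fun i _ => h i i

theorem analyticOnNhd_of_mem_polyFun {f : Module.Dual ℝ L → ℝ} (hf : f ∈ polyFun L) :
    AnalyticOnNhd ℝ (fun y => f (dualCoord L y)) Set.univ := by
  induction hf using Algebra.adjoin_induction with
  | mem f hf =>
    obtain ⟨Z, rfl⟩ := hf
    exact ((Module.Dual.eval ℝ L Z) ∘ₗ (dualCoord L).toLinearMap).toContinuousLinearMap.analyticOnNhd
      _
  | algebraMap r => exact analyticOnNhd_const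
  | add f₁ f₂ _ _ h₁ h₂ => exact h₁.add h₂
  | mul f₁ f₂ _ _ h₁ h₂ => exact h₁.mul h₂

theorem isSmooth_of_mem_polyFun {f : Module.Dual ℝ L → ℝ} (hf : f ∈ polyFun L) : IsSmooth f :=
  contDiffOn_univ.1 ((analyticOnNhd_of_mem_polyFun hf).contDiffOn uniqueDiffOn_univ)

/-- Identity theorem for real analytic functions. It upgrades independence of differentials at one
point to independence on a dense set. -/
theorem dense_ne_zero_of_mem_polyFun {f : Module.Dual ℝ L → ℝ} (hf : f ∈ polyFun L)
    {x : Module.Dual ℝ L} (hx : f x ≠ 0) : Dense {y | f (dualCoord L y) ≠ 0} := by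
  rw [dense_iff_inter_open]
  intro U hU ⟨y, hy⟩
  by_contra h
  have hzero : Set.EqOn (fun y => f (dualCoord L y)) 0 Set.univ := by
    refine (analyticOnNhd_of_mem_polyFun hf).eqOn_zero_of_preconnected_of_eventuallyEq_zero
      isPreconnected_univ (Set.mem_univ y) ?_
    filter_upwards [hU.mem_nhds hy] with z hz
    by_contra hz'
    exact h ⟨z, hz, hz'⟩
  exact hx (by simpa using hzero (Set.mem_univ ((dualCoord L).symm x)))

/-- The differential of a smooth function on the dual of `L`. -/
theorem IsSmooth.exists_lineDeriv_eq {f : Module.Dual ℝ L → ℝ} (hf : IsSmooth f)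
    (x : Module.Dual ℝ L) : ∃ l : Module.Dual ℝ L →ₗ[ℝ] ℝ, ∀ v, lineDeriv ℝ f x v = l v := by
  refine ⟨(fderiv ℝ (fun y => f (dualCoord L y)) ((dualCoord L).symm x)).toLinearMap ∘ₗ
    (dualCoord L).symm.toLinearMap, fun v => ?_⟩
  have h : DifferentiableAt ℝ (fun y => f (dualCoord L y)) ((dualCoord L).symm x) :=
    hf.differentiable (by simp) _
  rw [LinearMap.comp_apply]
  exact Eq.trans (by simp [lineDeriv]) (h.lineDeriv_eq_fderiv (v := (dualCoord L).symm v))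

/-- Bounds the set whose `sSup` defines `numCommonInvariants`; otherwise the supremum would be the
default value 0. -/
theorem FunctionallyIndependent.le_finrank {k : ℕ} {F : Fin k → Module.Dual ℝ L → ℝ}
    (hs : ∀ i, IsSmooth (F i)) (hF : FunctionallyIndependent F) : k ≤ Module.finrank ℝ L := by
  obtain ⟨y, hy⟩ := Dense.nonempty hF
  choose l hl using fun i => (hs i).exists_lineDeriv_eq (dualCoord L y)
  let c : (Module.Dual ℝ L →ₗ[ℝ] ℝ) →ₗ[ℝ] (Module.Dual ℝ L → ℝ) :=
    { toFun := fun l v => l v, map_add' := fun _ _ => rfl, map_smul' := fun _ _ => rfl }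
  have h : LinearIndependent ℝ (c ∘ l) := by
    convert (show LinearIndependent ℝ _ from hy) using 1
    ext i v
    exact (hl i v).symm
  have := (LinearIndependent.of_comp c h).fintype_card_le_finrank
  rw [Fintype.card_fin] at this
  exact this.trans_eq (by
    rw [show Module.finrank ℝ (Module.Dual ℝ L →ₗ[ℝ] ℝ) =
      Module.finrank ℝ (Module.Dual ℝ (Module.Dual ℝ L)) from rfl, Subspace.dual_finrank_eq,
      Subspace.dual_finrank_eq])

/-- Forms that separate points span the dual, so they contain a basis of it; the `v j` are its dual
basis. -/
theorem exists_dual_family {ι U : Type*} [AddCommGroup U] [Module ℝ U] [FiniteDimensional ℝ U]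
    (φ : ι → Module.Dual ℝ U) (hφ : ∀ u, (∀ i, φ i u = 0) → u = 0) :
    ∃ (s : Fin (Module.finrank ℝ U) → ι) (v : Fin (Module.finrank ℝ U) → U),
      ∀ i j, φ (s i) (v j) = if i = j then 1 else 0 := by
  have htop : Submodule.span ℝ (Set.range φ) = ⊤ := by
    rw [← Subspace.dualCoannihilator_dualAnnihilator_eq (W := Submodule.span ℝ (Set.range φ)),
      show (Submodule.span ℝ (Set.range φ)).dualCoannihilator = ⊥ from ?_,
      Submodule.dualAnnihilator_bot]
    rw [eq_bot_iff]
    intro u hu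
    rw [Submodule.mem_dualCoannihilator] at hu
    exact hφ u fun i => hu _ (Submodule.subset_span ⟨i, rfl⟩)
  obtain ⟨b, hb, hspan, hli⟩ := exists_linearIndependent ℝ (Set.range φ)
  rw [htop] at hspan
  let B : Module.Basis b ℝ (Module.Dual ℝ U) := Module.Basis.mk hli (by simp [hspan])
  have : Fintype b := FiniteDimensional.fintypeBasisIndex B
  have hcard : Fintype.card b = Module.finrank ℝ U := by
    rw [← Module.finrank_eq_card_basis B, Subspace.dual_finrank_eq]
  let e : Fin (Module.finrank ℝ U) ≃ b := (Fintype.equivFinOfCardEq hcard).symm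
  let B' := B.reindex e.symm
  choose s hs using fun i => hb (e i).2
  refine ⟨s, fun j => (Module.evalEquiv ℝ U).symm (B'.dualBasis j), fun i j => ?_⟩
  have h1 : φ (s i) = B' i := by
    rw [hs]; simp [B', B]
  rw [h1, Module.apply_evalEquiv_symm_apply, Module.Basis.dualBasis_apply_self]

/-- The number of common invariants is at least the rank of the differentials of any family of
polynomial ones at a point. -/
theorem finrank_le_numCommonInvariants {H : LieSubalgebra ℝ L} {ι : Type*}
    (F : ι → Module.Dual ℝ L → ℝ) (hF : ∀ i, F i ∈ polyFun L) (hinv : ∀ i, IsInvariant (F i))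
    (hdep : ∀ i, DependsOnlyOn H (F i)) (x : Module.Dual ℝ L)
    (U : Submodule ℝ (Module.Dual ℝ L))
    (hU : ∀ u ∈ U, (∀ i, lineDeriv ℝ (F i) x u = 0) → u = 0) :
    Module.finrank ℝ U ≤ numCommonInvariants H := by
  choose l hl using fun i => (isSmooth_of_mem_polyFun (hF i)).exists_lineDeriv_eq x
  obtain ⟨s, v, hsv⟩ := exists_dual_family (U := U) (fun i => l i ∘ₗ U.subtype) fun u hu =>
    Subtype.ext (hU (u : Module.Dual ℝ L) u.2 fun i => (hl i u).trans (hu i))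
  refine le_csSup ⟨Module.finrank ℝ L, ?_⟩ ⟨fun i => F (s i), fun i =>
    ⟨isSmooth_of_mem_polyFun (hF _), hinv _, hdep _⟩, ?_⟩
  · rintro k ⟨G, hG, hGi⟩
    exact hGi.le_finrank fun i => (hG i).1
  -- A minor of the Jacobian: its determinant is polynomial and equals 1 at the given point.
  let M (x : Module.Dual ℝ L) : Matrix (Fin (Module.finrank ℝ U)) (Fin (Module.finrank ℝ U)) ℝ :=
    Matrix.of fun i j => lineDeriv ℝ (F (s i)) x (v j)
  have hdet : (fun x => (M x).det) ∈ polyFun L := by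
    have : (fun x => (M x).det) = ∑ σ : Equiv.Perm (Fin (Module.finrank ℝ U)),
        ((Equiv.Perm.sign σ : ℤ) : ℝ) • ∏ i, fun x => lineDeriv ℝ (F (s (σ i))) x (v i) := by
      ext x
      simp [Matrix.det_apply', M]
    rw [this]
    exact (polyFun L).sum_mem fun σ _ => (polyFun L).smul_mem ((polyFun L).prod_mem fun i _ =>
      lineDeriv_mem_polyFun (hF _) _) _
  have hx : (M x).det ≠ 0 := by
    have : M x = 1 := by
      ext i j
      rw [Matrix.one_apply, ← hsv i j]
      exact hl _ _
    rw [this, Matrix.det_one]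
    exact one_ne_zero
  refine (dense_ne_zero_of_mem_polyFun hdet hx).mono fun y hy => ?_
  exact LinearIndependent.of_comp (LinearMap.funLeft ℝ ℝ fun j => (v j : Module.Dual ℝ L))
    (Matrix.linearIndependent_rows_of_det_ne_zero hy)

end Polynomial

/-! ### Derivatives of power traces -/

section TracePow

/-- The noncommutative power rule gives `k + 1` terms, all equal by cyclicity of `τ`. -/
theorem hasDerivAt_trace_pow_of_normedAlgebra {𝔸 : Type*} [NormedRing 𝔸] [NormedAlgebra ℝ 𝔸]
    [FiniteDimensional ℝ 𝔸] (τ : 𝔸 →ₗ[ℝ] ℝ) (hτ : ∀ a b, τ (a * b) = τ (b * a)) (A B : 𝔸) (k : ℕ) :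
    HasDerivAt (fun t : ℝ => τ ((A + t • B) ^ (k + 1))) ((k + 1) * τ (A ^ k * B)) 0 := by
  have h1 : HasDerivAt (fun t : ℝ => A + t • B) B 0 := by
    simpa only [one_smul, id] using ((hasDerivAt_id (0 : ℝ)).smul_const B).const_add A
  have h2 := τ.toContinuousLinearMap.hasFDerivAt.comp_hasDerivAt 0 (h1.fun_pow' (k + 1))
  refine h2.congr_deriv ?_
  rw [LinearMap.coe_toContinuousLinearMap', map_sum,
    Finset.sum_congr rfl (g := fun _ => τ (A ^ k * B))]
  · simp
  · intro i hi
    rw [zero_smul, add_zero, hτ, ← mul_assoc, ← pow_add]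
    congr 3
    simp at hi ⊢
    lia

theorem hasDerivAt_trace_pow {V : Type*} [AddCommGroup V] [Module ℝ V] [FiniteDimensional ℝ V]
    (A B : Module.End ℝ V) (k : ℕ) :
    HasDerivAt (fun t : ℝ => LinearMap.trace ℝ V ((A + t • B) ^ (k + 1)))
      ((k + 1) * LinearMap.trace ℝ V (A ^ k * B)) 0 := by
  let e := (Module.finBasis ℝ V).equivFun
  let E : Module.End ℝ V ≃ₐ[ℝ] _ := e.conjAlgEquiv ℝ |>.trans
    (Module.End.toContinuousLinearMap (Fin (Module.finrank ℝ V) → ℝ))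
  let τ := LinearMap.trace ℝ V ∘ₗ E.symm.toLinearMap
  have h := hasDerivAt_trace_pow_of_normedAlgebra τ
    (fun a b => by simp [τ, LinearMap.trace_mul_comm ℝ (E.symm a)]) (E A) (E B) k
  have hE (t : ℝ) : τ ((E A + t • E B) ^ (k + 1)) = LinearMap.trace ℝ V ((A + t • B) ^ (k + 1)) := by
    rw [← map_smul, ← map_add, ← map_pow]
    simp [τ]
  have hE' : τ (E A ^ k * E B) = LinearMap.trace ℝ V (A ^ k * B) := by
    rw [← map_pow, ← map_mul]
    simp [τ]
  simpa only [hE, hE'] using h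

end TracePow

/-! ### Rank inequality for alternating forms -/

section Rank

/-- For an alternating form `β` and a linear map `i` into its domain, the rank of `β` is at least
twice the rank of `β ∘ i` minus the rank of the form induced by `β` through `i`. -/
theorem two_mul_finrank_le_of_skew {V U : Type*} [AddCommGroup V] [Module ℝ V]
    [FiniteDimensional ℝ V] [AddCommGroup U] [Module ℝ U] [FiniteDimensional ℝ U]
    (β : V →ₗ[ℝ] Module.Dual ℝ V) (hβ : ∀ u v, β u v = -β v u) (i : U →ₗ[ℝ] V) :
    2 * Module.finrank ℝ U ≤ Module.finrank ℝ (LinearMap.range β) +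
      Module.finrank ℝ (LinearMap.range (i.dualMap ∘ₗ β ∘ₗ i)) +
      2 * Module.finrank ℝ (LinearMap.ker (β ∘ₗ i)) := by
  let g := β ∘ₗ i
  let k := LinearMap.ker (i.dualMap ∘ₗ g)
  let q : Module.Dual ℝ V →ₗ[ℝ] Module.Dual ℝ k := (i ∘ₗ k.subtype).dualMap
  have hNk : LinearMap.ker g ≤ k := LinearMap.ker_le_ker_comp _ _
  have h1 := LinearMap.finrank_range_add_finrank_ker g
  have h2 := LinearMap.finrank_range_add_finrank_ker (i.dualMap ∘ₗ g)
  have h3 := LinearMap.finrank_range_add_finrank_ker (g ∘ₗ k.subtype)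
  have h4 : Module.finrank ℝ (LinearMap.ker (g ∘ₗ k.subtype)) =
      Module.finrank ℝ (LinearMap.ker g) := by
    rw [LinearMap.ker_comp]
    exact (Submodule.comapSubtypeEquivOfLe hNk).finrank_eq
  have h5 := LinearMap.finrank_range_add_finrank_ker (K := ℝ) (V := LinearMap.range β)
    (V₂ := Module.Dual ℝ k) (q.domRestrict (LinearMap.range β))
  -- `k` is the radical of the induced form, so restriction to `k` kills `range g`. By skewness
  -- (`h7`) the restriction of `range β` to `k` has the rank of `g` on `k`. Rank-nullity adds the
  -- two contributions.
  have h6 : Module.finrank ℝ (LinearMap.range g) ≤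
      Module.finrank ℝ (LinearMap.ker (q.domRestrict (LinearMap.range β))) := by
    have hle : LinearMap.range g ≤
        (LinearMap.ker (q.domRestrict (LinearMap.range β))).map (LinearMap.range β).subtype := by
      rintro _ ⟨u, rfl⟩
      refine ⟨⟨β (i u), i u, rfl⟩, ?_, rfl⟩
      refine LinearMap.ext fun v => ?_
      have hv : β (i v) (i u) = 0 := LinearMap.congr_fun v.2 u
      change β (i u) (i v) = 0
      rw [hβ, hv, neg_zero]
    refine (Submodule.finrank_mono hle).trans ?_
    exact Submodule.finrank_map_le _ _
  have h7 : Module.finrank ℝ (LinearMap.range (q.domRestrict (LinearMap.range β))) =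
      Module.finrank ℝ (LinearMap.range (g ∘ₗ k.subtype)) := by
    rw [← LinearMap.finrank_range_dualMap_eq_finrank_range (g ∘ₗ k.subtype)]
    refine congrArg (fun p : Submodule ℝ (Module.Dual ℝ k) => Module.finrank ℝ p) ?_
    ext l
    constructor
    · rintro ⟨⟨_, v, rfl⟩, rfl⟩
      refine ⟨-(Module.Dual.eval ℝ V v), LinearMap.ext fun u => ?_⟩
      change -(β (i u) v) = β v (i u)
      rw [hβ v]
    · rintro ⟨φ, rfl⟩
      obtain ⟨v, rfl⟩ := (Module.evalEquiv ℝ V).surjective φ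
      refine ⟨⟨β (-v), -v, rfl⟩, LinearMap.ext fun u => ?_⟩
      change β (-v) (i u) = β (i u) v
      rw [hβ, map_neg, neg_neg]
  change 2 * Module.finrank ℝ U ≤ _ + Module.finrank ℝ (LinearMap.range (i.dualMap ∘ₗ g)) +
    2 * Module.finrank ℝ (LinearMap.ker g)
  change _ + Module.finrank ℝ k = _ at h2
  lia

theorem finrank_range_commutatorForm_le {L : Type*} [LieRing L] [LieAlgebra ℝ L]
    [FiniteDimensional ℝ L] (x : Module.Dual ℝ L) :
    Module.finrank ℝ (LinearMap.range (commutatorForm L x)) ≤ commutatorRank L :=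
  le_ciSup (f := fun x : Module.Dual ℝ L =>
    Module.finrank ℝ (LinearMap.range (commutatorForm L x)))
    ⟨Module.finrank ℝ L, by rintro _ ⟨x, rfl⟩; exact LinearMap.finrank_range_le _⟩ x

theorem coe_numInvariants (L : Type*) [LieRing L] [LieAlgebra ℝ L] [FiniteDimensional ℝ L] :
    (numInvariants L : ℤ) = Module.finrank ℝ L - commutatorRank L :=
  Nat.cast_sub (ciSup_le fun _ => LinearMap.finrank_range_le _)

/-- In terms of generic ranks, $m=\operatorname{rank}L+\operatorname{rank}H-2\dim H+2l'$. Ranks at a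
single point bound the generic ones from below, so one point with small stabilizer in `H` suffices.
-/
theorem numLabelling_nonneg_of_finrank_ker_le {L : Type*} [LieRing L] [LieAlgebra ℝ L]
    [FiniteDimensional ℝ L] (H : LieSubalgebra ℝ L) (x : Module.Dual ℝ L)
    (hx : Module.finrank ℝ (LinearMap.ker (commutatorForm L x ∘ₗ H.toSubmodule.subtype)) ≤
      numCommonInvariants H) : 0 ≤ numLabelling H := by
  have hskew (u v : L) : commutatorForm L x u v = -commutatorForm L x v u := by
    change x ⁅u, v⁆ = -x ⁅v, u⁆
    rw [← lie_skew, map_neg]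
  have h1 := two_mul_finrank_le_of_skew (commutatorForm L x) hskew H.toSubmodule.subtype
  have h3 := finrank_range_commutatorForm_le x
  have h4 : Module.finrank ℝ (LinearMap.range (H.toSubmodule.subtype.dualMap ∘ₗ
      commutatorForm L x ∘ₗ H.toSubmodule.subtype)) ≤ commutatorRank H :=
    finrank_range_commutatorForm_le (L := H) (x ∘ₗ H.toSubmodule.subtype)
  change 2 * Module.finrank ℝ H ≤ _ at h1
  rw [numLabelling, coe_numInvariants, coe_numInvariants]
  lia

end Rank

/-- The Killing form is nondegenerate on the centralizer of `e` in the ideal `Q`: elements of this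
centralizer are orthogonal to $[e,S]$ and to the orthogonal ideal of `Q`, which together with the
centralizer itself span `S`. -/
theorem eq_zero_of_killingForm_centralizer {K S : Type*} [Field K] [LieRing S] [LieAlgebra K S]
    [FiniteDimensional K S] [LieAlgebra.IsKilling K S] {e : S}
    (he : ∀ x : S, ∃ a b : S, ⁅e, a⁆ = 0 ∧ a + ⁅e, b⁆ = x) (Q : LieIdeal K S) {a : S} (ha : a ∈ Q)
    (hea : ⁅e, a⁆ = 0) (h : ∀ b ∈ Q, ⁅e, b⁆ = 0 → killingForm K S b a = 0) : a = 0 := by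
  rw [← Submodule.mem_bot K, ← LieAlgebra.IsKilling.ker_killingForm_eq_bot K S, LinearMap.mem_ker]
  ext x
  obtain ⟨t, u, ht, rfl⟩ := he x
  have h1 : killingForm K S a ⁅e, u⁆ = 0 := by
    rw [← LieModule.traceForm_apply_lie_apply, ← lie_skew, hea, neg_zero, map_zero,
      LinearMap.zero_apply]
  have hC := LieIdeal.isCompl_killingCompl Q
  obtain ⟨q, hq, q', hq', rfl⟩ := (LieSubmodule.mem_sup _ _ _).1
    (show t ∈ Q ⊔ Q.killingCompl by rw [hC.sup_eq_top]; exact LieSubmodule.mem_top t)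
  have heq : ⁅e, q⁆ = 0 := by
    rw [lie_add] at ht
    have hmem : ⁅e, q⁆ ∈ Q ⊓ Q.killingCompl := by
      refine ⟨Q.lie_mem hq, ?_⟩
      rw [eq_neg_of_add_eq_zero_left ht]
      exact neg_mem (Q.killingCompl.lie_mem hq')
    rwa [hC.inf_eq_bot, LieSubmodule.mem_bot] at hmem
  have h2 : killingForm K S a q = 0 := by
    rw [LieModule.traceForm_comm]; exact h q hq heq
  have h3 : killingForm K S a q' = 0 := (LieIdeal.mem_killingCompl K S Q).1 hq' a ha
  rw [map_add, map_add, h1, h2, h3, add_zero, add_zero, LinearMap.zero_apply]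

/-! ### Common invariants and nonnegativity of the number of labelling operators -/

section Existence

/-- The linear map that represents the restriction of a functional on `L` to an ideal `Q` of a
subquotient `S` with non-degenerate Killing form. -/
theorem exists_killing_restriction {L S : Type*} [AddCommGroup L] [Module ℝ L] [LieRing S]
    [LieAlgebra ℝ S] [FiniteDimensional ℝ S] [LieAlgebra.IsKilling ℝ S] (Q : LieIdeal ℝ S)
    (j : S →ₗ[ℝ] L) :
    ∃ θ : Module.Dual ℝ L →ₗ[ℝ] Q,
      (∀ x (q : Q), killingForm ℝ S (θ x) q = x (j q)) ∧
      ∀ x (a : Q), (∀ q : Q, killingForm ℝ S a q = x (j q)) → θ x = a := by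
  let B : Q →ₗ[ℝ] Module.Dual ℝ Q :=
    Q.toSubmodule.subtype.dualMap ∘ₗ killingForm ℝ S ∘ₗ Q.toSubmodule.subtype
  have hB (a b : Q) : B a b = killingForm ℝ S a b := rfl
  -- The Killing form stays nondegenerate on an ideal, because `S` is the direct sum of `Q` and its
  -- orthogonal.
  have hinj : Function.Injective B := by
    rw [injective_iff_map_eq_zero]
    intro a ha
    have h : (a : S) ∈ Q ⊓ Q.killingCompl := by
      refine ⟨a.2, (LieIdeal.mem_killingCompl ℝ S Q).2 fun y hy => ?_⟩
      rw [LieModule.traceForm_comm]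
      exact LinearMap.congr_fun ha ⟨y, hy⟩
    rw [(LieIdeal.isCompl_killingCompl Q).inf_eq_bot, LieSubmodule.mem_bot] at h
    exact Subtype.ext h
  let E := LinearMap.linearEquivOfInjective B hinj (Subspace.dual_finrank_eq).symm
  have hE (a : Q) : E a = B a := rfl
  let r : Module.Dual ℝ L →ₗ[ℝ] Module.Dual ℝ Q := (j ∘ₗ Q.toSubmodule.subtype).dualMap
  refine ⟨E.symm.toLinearMap ∘ₗ r, fun x q => ?_, fun x a h => ?_⟩
  · change B (E.symm (r x)) q = r x q
    rw [← hE, E.apply_symm_apply]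
  · refine E.symm_apply_eq.2 (LinearMap.ext fun q => ?_)
    exact (h q).symm

variable {L : Type*} [LieRing L] [LieAlgebra ℝ L] [FiniteDimensional ℝ L]

/-- By `hI`, every element of `L` acts on `I` like one of `H`, so invariants of `H` built from the
variables of `I` are invariants of `L`: power traces of the Killing representative on `Q`, and the
central variables. -/
theorem finrank_add_finrank_le_numCommonInvariants (H : LieSubalgebra ℝ L) {S : LieIdeal ℝ H}
    (hS : IsCompl S (LieAlgebra.center ℝ H)) [LieAlgebra.IsKilling ℝ S] {e : S}
    (he : ∀ a b : S, ⁅e, a⁆ = 0 → ⁅e, b⁆ = 0 → ⁅a, b⁆ = 0)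
    (he' : ∀ x : S, ∃ a b : S, ⁅e, a⁆ = 0 ∧ a + ⁅e, b⁆ = x) (I : LieIdeal ℝ H)
    (hI : ∀ X : L, ∃ u : H, ∀ q ∈ I, ⁅X, (q : L)⁆ = (⁅u, q⁆ : H)) (Q : LieIdeal ℝ S)
    (hQ : ∀ a ∈ Q, (a : H) ∈ I) (T : Submodule ℝ Q) (hT : ∀ a ∈ T, ⁅e, (a : S)⁆ = 0)
    (hT' : ∀ a : Q, ⁅e, (a : S)⁆ = 0 → a ∈ T) :
    Module.finrank ℝ T +
      Module.finrank ℝ (I ⊓ LieAlgebra.center ℝ H : LieIdeal ℝ H) ≤ numCommonInvariants H := by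
  let Z : LieIdeal ℝ H := I ⊓ LieAlgebra.center ℝ H
  change _ + Module.finrank ℝ Z ≤ _
  let jS : S →ₗ[ℝ] L := H.toSubmodule.subtype ∘ₗ S.toSubmodule.subtype
  let jZ : Z →ₗ[ℝ] L := H.toSubmodule.subtype ∘ₗ Z.toSubmodule.subtype
  obtain ⟨θ, hθ, hθ'⟩ := exists_killing_restriction Q jS
  let D : Module.Dual ℝ L →ₗ[ℝ] Module.End ℝ S :=
    (LieAlgebra.ad ℝ S : S →ₗ[ℝ] Module.End ℝ S) ∘ₗ Q.toSubmodule.subtype ∘ₗ θ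
  have hD (x) : D x = LieAlgebra.ad ℝ S (θ x) := rfl
  -- The exponent `k + 1` makes the differentials the traces against all powers `D x ^ k`, including
  -- `k = 0`.
  let F : ℕ ⊕ Z → Module.Dual ℝ L → ℝ :=
    Sum.elim (fun k x => LinearMap.trace ℝ S (D x ^ (k + 1))) fun z x => x (jZ z)
  have hFk (k : ℕ) (x v : Module.Dual ℝ L) :
      lineDeriv ℝ (F (Sum.inl k)) x v = (k + 1) * LinearMap.trace ℝ S (D x ^ k * D v) := by
    refine HasLineDerivAt.lineDeriv ?_
    have := hasDerivAt_trace_pow (D x) (D v) k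
    change HasDerivAt (fun t : ℝ => LinearMap.trace ℝ S (D (x + t • v) ^ (k + 1))) _ 0
    simpa only [map_add, map_smul] using this
  have hFz (z : Z) (x v : Module.Dual ℝ L) : lineDeriv ℝ (F (Sum.inr z)) x v = v (jZ z) := by
    refine HasLineDerivAt.lineDeriv ?_
    have : HasDerivAt (fun t : ℝ => x (jZ z) + t * v (jZ z)) (v (jZ z)) 0 := by
      simpa using ((hasDerivAt_id (0 : ℝ)).mul_const (v (jZ z))).const_add (x (jZ z))
    exact this
  have hFpoly (i) : F i ∈ polyFun L := by
    rcases i with k | z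
    · exact trace_pow_mem_polyFun D (k + 1)
    · exact apply_mem_polyFun (jZ z)
  have hcenter (z : H) (hz : z ∈ LieAlgebra.center ℝ H) (u : H) : ⁅u, z⁆ = 0 :=
    (LieModule.mem_maxTrivSubmodule ℝ H H z).1 hz u
  have hFinv (i) : IsInvariant (F i) := by
    intro X x
    obtain ⟨u, hu⟩ := hI X
    rcases i with k | z
    · obtain ⟨s, hs, z, hz, rfl⟩ := (LieSubmodule.mem_sup _ _ _).1
        (show u ∈ S ⊔ LieAlgebra.center ℝ H by
          rw [hS.sup_eq_top]; exact LieSubmodule.mem_top u)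
      have hv : θ (commutatorForm L x X) = -(⁅(⟨s, hs⟩ : S), θ x⁆ : Q) := by
        refine hθ' _ _ fun q => ?_
        have h1 : ⁅X, jS q⁆ = jS (⁅(⟨s, hs⟩ : S), q⁆ : Q) := by
          refine (hu _ (hQ q q.2)).trans ?_
          rw [add_lie, ← lie_skew z, hcenter z hz, neg_zero, add_zero]
          rfl
        change _ = x ⁅X, jS q⁆
        rw [h1, ← hθ]
        change killingForm ℝ S (-⁅(⟨s, hs⟩ : S), (θ x : S)⁆) q =
          killingForm ℝ S (θ x) ⁅(⟨s, hs⟩ : S), (q : S)⁆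
        rw [lie_skew, LieModule.traceForm_apply_lie_apply]
      have hDv : D (commutatorForm L x X) =
          D x * LieAlgebra.ad ℝ S ⟨s, hs⟩ - LieAlgebra.ad ℝ S ⟨s, hs⟩ * D x := by
        refine LinearMap.ext fun r => ?_
        rw [hD, hv]
        change ⁅-⁅(⟨s, hs⟩ : S), (θ x : S)⁆, r⁆ =
          ⁅(θ x : S), ⁅(⟨s, hs⟩ : S), r⁆⁆ - ⁅(⟨s, hs⟩ : S), ⁅(θ x : S), r⁆⁆
        rw [lie_skew, lie_lie]
      rw [hFk, hDv, mul_sub, map_sub, ← mul_assoc, ← mul_assoc, ← pow_succ,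
        LinearMap.trace_mul_comm ℝ (D x ^ k * _) (D x), ← mul_assoc, ← pow_succ', sub_self,
        mul_zero]
    · rw [hFz]
      change x ⁅X, ((z : H) : L)⁆ = 0
      rw [hu _ z.2.1, hcenter _ z.2.2, ZeroMemClass.coe_zero, map_zero]
  have hFdep (i) : DependsOnlyOn H (F i) := by
    intro x y hxy
    rcases i with k | z
    · have : θ x = θ y := hθ' _ _ fun q => (hθ y q).trans (hxy _ (q : S).1.2).symm
      change LinearMap.trace ℝ S (D x ^ (k + 1)) = LinearMap.trace ℝ S (D y ^ (k + 1))
      rw [hD, hD, this]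
    · exact hxy _ (z : H).2
  let Θ : Module.Dual ℝ L →ₗ[ℝ] Q × Module.Dual ℝ Z := θ.prod jZ.dualMap
  have hΘ : Function.Surjective Θ := by
    rintro ⟨a, l⟩
    let j : Q × Z →ₗ[ℝ] L := (jS ∘ₗ Q.toSubmodule.subtype).coprod jZ
    have hj : Function.Injective j := by
      rw [injective_iff_map_eq_zero]
      rintro ⟨q, z⟩ h
      have h0 : ((q : S) : H) + (z : H) = 0 := Subtype.ext h
      have h1 : (z : H) ∈ S ⊓ LieAlgebra.center ℝ H := by
        refine ⟨?_, z.2.2⟩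
        rw [← neg_eq_of_add_eq_zero_right h0]
        exact neg_mem (q : S).2
      rw [hS.inf_eq_bot, LieSubmodule.mem_bot] at h1
      rw [h1, add_zero] at h0
      exact Prod.ext (Subtype.ext (Subtype.ext h0)) (Subtype.ext h1)
    obtain ⟨v, hv⟩ := LinearMap.dualMap_surjective_of_injective hj
      ((Q.toSubmodule.subtype.dualMap (killingForm ℝ S a)).coprod l)
    refine ⟨v, Prod.ext (hθ' v a fun q => ?_) (LinearMap.ext fun z => ?_)⟩
    · have := LinearMap.congr_fun hv (q, 0)
      simpa [j] using this.symm
    · have := LinearMap.congr_fun hv (0, z)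
      simpa [j, Θ] using this
  obtain ⟨σ, hσ⟩ := LinearMap.exists_rightInverse_of_surjective Θ (LinearMap.range_eq_top.2 hΘ)
  have hσ' (p) : Θ (σ p) = p := LinearMap.congr_fun hσ p
  -- The directions to be tested: `σ` lifts prescribed Killing representatives in `T` and prescribed
  -- values on `Z` to functionals on `L`.
  let U := LinearMap.range (σ ∘ₗ T.subtype.prodMap LinearMap.id)
  have hU : Module.finrank ℝ U = Module.finrank ℝ T + Module.finrank ℝ Z := by
    rw [LinearMap.finrank_range_of_inj, Module.finrank_prod, Subspace.dual_finrank_eq]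
    refine Function.Injective.comp (g := σ) (Function.LeftInverse.injective hσ') ?_
    exact Function.Injective.prodMap T.injective_subtype Function.injective_id
  rw [← hU]
  -- The functional with representative `t` is the base point: there, vanishing of all differentials
  -- along `a ∈ T` makes `a` Killing-orthogonal to `T`, hence zero.
  obtain ⟨t, ht⟩ := exists_trace_pow_mul_eq_zero_imp
    ((LieAlgebra.ad ℝ S : S →ₗ[ℝ] Module.End ℝ S) ∘ₗ Q.toSubmodule.subtype ∘ₗ T.subtype)
    fun a b => by
      have h := he a b (hT a a.2) (hT b b.2)
      refine LinearMap.ext fun r => sub_eq_zero.1 ?_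
      change ⁅((a : Q) : S), ⁅((b : Q) : S), r⁆⁆ - ⁅((b : Q) : S), ⁅((a : Q) : S), r⁆⁆ = 0
      rw [← lie_lie, h, zero_lie]
  refine finrank_le_numCommonInvariants F hFpoly hFinv hFdep (σ (t, 0)) U ?_
  rintro _ ⟨⟨a, l⟩, rfl⟩ h
  have hx0 : θ (σ (t, 0)) = t := congrArg Prod.fst (hσ' (t, 0))
  have hv : θ (σ ((a : Q), l)) = a := congrArg Prod.fst (hσ' ((a : Q), l))
  have hl : l = 0 := by
    ext z
    have h1 := h (Sum.inr z)
    rw [hFz] at h1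
    have h2 : jZ.dualMap (σ ((a : Q), l)) = l := congrArg Prod.snd (hσ' ((a : Q), l))
    rw [← h2]
    exact h1
  have ha : ((a : Q) : S) = 0 := by
    refine eq_zero_of_killingForm_centralizer he' Q (a : Q).2 (hT a a.2) fun b hb hb' => ?_
    refine ht a (fun k => ?_) ⟨⟨b, hb⟩, hT' ⟨b, hb⟩ hb'⟩
    have h1 := h (Sum.inl k)
    rw [hFk] at h1
    change _ * LinearMap.trace ℝ S (LieAlgebra.ad ℝ S (θ (σ (t, 0))) ^ k *
      LieAlgebra.ad ℝ S (θ (σ ((a : Q), l)))) = 0 at h1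
    rw [hx0, hv] at h1
    exact (mul_eq_zero.1 h1).resolve_left (by positivity)
  have ha' : a = 0 := Subtype.ext (Subtype.ext ha)
  rw [ha', hl]
  exact map_zero _

/-- If `L` is a completely reducible representation of `H`, then the number of available labelling
operators of the chain `L ⊃ H` is not negative. -/
theorem IsCompletelyReducible.numLabelling_nonneg {H : LieSubalgebra ℝ L}
    (hc : IsCompletelyReducible H) : 0 ≤ numLabelling H := by
  have : ComplementedLattice (LieSubmodule ℝ H L) := hc
  obtain ⟨W, hW⟩ := exists_isCompl H.toLieSubmodule
  have : ComplementedLattice (LieIdeal ℝ H) :=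
    complementedLattice_of_injective H.incl' Subtype.val_injective
  have : ComplementedLattice (LieSubmodule ℝ H W) :=
    complementedLattice_of_injective W.incl Subtype.val_injective
  obtain ⟨S, hS⟩ := exists_isCompl (LieAlgebra.center ℝ H)
  replace hS := hS.symm
  -- In characteristic zero a trivial radical makes the Killing form of `S` nondegenerate.
  have := hasTrivialRadical_of_isCompl_center hS
  obtain ⟨e, he, he'⟩ := exists_isLieAbelian_centralizer ℝ S
  obtain ⟨y, w, hyw⟩ := exists_generic_stabilizer (M := W) hS he he'
  have hW' : IsCompl H.toSubmodule W.toSubmodule :=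
    (LieSubmodule.isCompl_toSubmodule (N := H.toLieSubmodule) (N' := W)).2 hW
  let x : Module.Dual ℝ L := y ∘ₗ Submodule.projectionOnto _ _ hW' +
    w ∘ₗ Submodule.projectionOnto _ _ hW'.symm
  have hxH (u : H) : x u = y u := by
    change y (Submodule.projectionOnto _ _ hW' (u : L)) +
      w (Submodule.projectionOnto _ _ hW'.symm (u : L)) = _
    rw [Submodule.projectionOnto_apply_left hW' u,
      Submodule.projectionOnto_apply_right hW'.symm u, map_zero, add_zero]
  have hxW (m : W) : x m = w m := by
    change y (Submodule.projectionOnto _ _ hW' (m : L)) +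
      w (Submodule.projectionOnto _ _ hW'.symm (m : L)) = _
    rw [Submodule.projectionOnto_apply_left hW'.symm m,
      Submodule.projectionOnto_apply_right hW' m, map_zero, zero_add]
  let I : LieIdeal ℝ H := LieModule.ker ℝ H W
  have hI (u : H) : u ∈ I ↔ ∀ m : W, ⁅u, m⁆ = 0 := LieModule.mem_ker ℝ H W u
  let Q : LieIdeal ℝ S := I.comap S.incl
  let T : Submodule ℝ Q := LinearMap.ker (LieModule.toEnd ℝ S Q e)
  have hT (a : Q) : a ∈ T ↔ ⁅e, (a : S)⁆ = 0 :=
    ⟨fun h => congrArg Subtype.val h, fun h => Subtype.ext h⟩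
  refine numLabelling_nonneg_of_finrank_ker_le H x (le_trans ?_
    (finrank_add_finrank_le_numCommonInvariants H hS he he' I ?_ Q (fun a ha => ha) T
      (fun a => (hT a).1) fun a => (hT a).2))
  · let Z : LieIdeal ℝ H := I ⊓ LieAlgebra.center ℝ H
    let jT : T →ₗ[ℝ] H := S.toSubmodule.subtype ∘ₗ Q.toSubmodule.subtype ∘ₗ T.subtype
    let j : T × Z →ₗ[ℝ] H := jT.coprod Z.toSubmodule.subtype
    -- The stabilizer lies in `I` and centralizes `e`. Splitting $I=[I,I]+I\cap Z(H)$ with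
    -- $[I,I]\subset S$ puts its elements into the sum of `T` and `Z`.
    have hle : LinearMap.ker (commutatorForm L x ∘ₗ H.toSubmodule.subtype) ≤
        LinearMap.range j := by
      intro (u : H) hu
      have hu' (Y : L) : x ⁅(u : L), Y⁆ = 0 := LinearMap.congr_fun hu Y
      obtain ⟨h1, h2⟩ := hyw u (fun z => by rw [← hxH]; exact hu' z)
        (fun m => by rw [← hxW]; exact hu' m)
      obtain ⟨a, ha, z, hz, rfl⟩ := (LieSubmodule.mem_sup _ _ _).1
        (le_lie_sup_center I ((hI u).2 h1))
      have haS : a ∈ S :=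
        lie_le_of_isCompl_center hS I (LieSubmodule.mono_lie_left _ le_top ha)
      have haI : a ∈ I := LieSubmodule.lie_le_right I I ha
      rw [lie_add, (LieModule.mem_maxTrivSubmodule ℝ H H z).1 hz.2, add_zero] at h2
      exact ⟨(⟨⟨⟨a, haS⟩, haI⟩, (hT _).2 (Subtype.ext h2)⟩, ⟨z, hz⟩), rfl⟩
    refine (Submodule.finrank_mono hle).trans ((LinearMap.finrank_range_le j).trans ?_)
    rw [Module.finrank_prod]
  · intro X
    obtain ⟨u, hu, m, hm, rfl⟩ := (LieSubmodule.mem_sup _ _ _).1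
      (show X ∈ H.toLieSubmodule ⊔ W by rw [hW.sup_eq_top]; exact LieSubmodule.mem_top X)
    refine ⟨⟨u, hu⟩, fun q hq => ?_⟩
    have h1 : ⁅(q : L), m⁆ = 0 := congrArg Subtype.val ((hI q).1 hq ⟨m, hm⟩)
    rw [add_lie, ← lie_skew m, h1, neg_zero, add_zero]
    rfl

end Existence

end LieLabelling

theorem proposition1
    {s : Type*} [LieRing s] [LieAlgebra ℝ s] [FiniteDimensional ℝ s]
    {g : Type*} [LieRing g] [LieAlgebra ℝ g] [FiniteDimensional ℝ g]
    (c : LieLabelling.Contraction s g) (s' : LieSubalgebra ℝ s) (hs' : c.Fixes s') :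
    (c.Commutes s' ∨ LieLabelling.IsCompletelyReducible s' →
      (LieLabelling.numInvariants g : ℤ) = LieLabelling.numInvariants s
        + LieLabelling.numLabelling s' - LieLabelling.numLabelling (c.image s' hs')) ∧
    (LieLabelling.IsCompletelyReducible s' →
      (LieLabelling.numInvariants g : ℤ) ≤ LieLabelling.numInvariants s
        + LieLabelling.numLabelling s') := by
  have key : c.Commutes s' ∨ LieLabelling.IsCompletelyReducible s' →
      (LieLabelling.numInvariants g : ℤ) = LieLabelling.numInvariants s
        + LieLabelling.numLabelling s' - LieLabelling.numLabelling (c.image s' hs') := by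
    intro h
    obtain ⟨e, he⟩ := c.exists_isIntertwiner s' hs' h
    -- After matching $l'$, $\mathcal N(\mathfrak s')$ and both dimensions, the labelling numbers
    -- differ only in $\mathcal N(\mathfrak s)$ and $\mathcal N(\mathfrak g)$.
    rw [LieLabelling.numLabelling, LieLabelling.numLabelling, he.numCommonInvariants_eq,
      LieLabelling.numInvariants_eq_of_lieEquiv he.lieEquiv, e.finrank_eq,
      he.lieEquiv.toLinearEquiv.finrank_eq]
    ring
  refine ⟨key, fun h => ?_⟩
  obtain ⟨e, he⟩ := c.exists_isIntertwiner s' hs' (Or.inr h)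
  rw [key (Or.inr h)]
  have := (he.isCompletelyReducible h).numLabelling_nonneg
  lia
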